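/- Let $X$ be a nonempty countable set with a measure $m\colon X\to(0,\infty)$, and let $(b,c)$ be a connected graph over $(X,m)$: $b\colon X\times X\to[0,\infty)$ satisfies $b(x,y)=b(y,x)$, $b(x,x)=0$, $\sum_{y}b(x,y)<\infty$ for all $x,y\in X$; $c\colon X\to[0,\infty)$; and any two vertices are joined by a finite sequence of vertices whose consecutive members have $b>0$. Let $\ell^2(X,m)$ be the real Hilbert space of $f\colon X\to\mathbb R$ with $\|f\|^2=\sum_x f(x)^2m(x)<\infty$, let $C_c(X)$ be the finitely supported functions, let $\mathcal D$ be the set of $f\colon X\to\mathbb R$ with $\sum_{x,y}b(x,y)(f(x)-f(y))^2+\sum_x c(x)f(x)^2<\infty$, and for $f,g\in\mathcal D$ let $$\mathcal Q(f,g)=\tfrac12\sum_{x,y}b(x,y)(f(x)-f(y))(g(x)-g(y))+\sum_x c(x)f(x)g(x).$$ Let $Q^{(N)}$ be the restriction of $\mathcal Q$ to $\mathcal D\cap\ell^2(X,m)$, and let $Q^{(D)}$ be the restriction of $\mathcal Q$ to the closure of $C_c(X)$ in $\mathcal D\cap\ell^2(X,m)$ with respect to the norm $(\mathcal Q(f,f)+\|f\|^2)^{1/2}$.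 Let $L^{(D)}$ be the operator on $\ell^2(X,m)$ associated with $Q^{(D)}$ and $P^{(D)}_t=e^{-tL^{(D)}}$, $t\ge0$, its semigroup. Let $(X_k)_{k\ge 0}$ be an increasing sequence of finite subsets of $X$ with union $X$ such that the restriction of $b$ to $X_k\times X_k$ is connected for every $k$. On functions $f$ on $X_k$ let $$L^{(N)}_kf(x)=\frac1{m(x)}\sum_{y\in X_k}b(x,y)(f(x)-f(y))+\frac{c(x)}{m(x)}f(x),\qquad x\in X_k,$$ and let $P^{(N)}_{t,k}$ be the operator on $\ell^2(X,m)$ that restricts a function to $X_k$, applies $e^{-tL^{(N)}_k}$, and extends the result by $0$ to $X$. Let $t>0$. The following statements are equivalent: (i) $Q^{(D)}=Q^{(N)}$. (ii) $P^{(N)}_{t,k}\to P^{(D)}_t$ strongly in $\ell^2(X,m)$ as $k\to\infty$. (iii) $P^{(N)}_{t,k}\varphi\to P^{(D)}_t\varphi$ pointwise on $X$ as $k\to\infty$ for some $\varphi\in C_c(X)$, $\varphi\ne0$, of constant sign (that is, $\varphi\ge0$ or $\varphi\le0$). (iv) $P^{(N)}_{t,k}\varphi\to P^{(D)}_t\varphi$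 pointwise on $X$ as $k\to\infty$ for all $\varphi\in C_c(X)$ with $\varphi\ne0$. -/

import Mathlib

open Filter Topology

noncomputable section

/-- A graph `(b, c)` over `(X, m)`: `m` is a vertex measure of full support, `b` are the edge
weights and `c` is the killing term. -/
structure GraphOver (X : Type*) where
  m : X → ℝ
  b : X → X → ℝ
  c : X → ℝ
  m_pos : ∀ x, 0 < m x
  b_nonneg : ∀ x y, 0 ≤ b x y
  b_symm : ∀ x y, b x y = b y x
  b_self : ∀ x, b x x = 0
  b_summable : ∀ x, Summable (fun y => b x y)
  c_nonneg : ∀ x, 0 ≤ c x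

/-- A form on `H` given on a subspace: its domain and its values there. Two forms are equal iff their
domains and their values coincide. -/
structure PartialForm (H : Type*) [AddCommGroup H] [Module ℝ H] where
  domain : Submodule ℝ H
  toFun : domain → domain → ℝ

/-- The graph of the operator `L` coming from a form `Q`: `L f = g` iff `f ∈ D(Q)` and
`Q(f, h) = ⟨g, h⟩` for all `h ∈ D(Q)`. -/
def PartialForm.operatorGraph {H : Type*} [NormedAddCommGroup H] [InnerProductSpace ℝ H]
    (Q : PartialForm H) : Set (H × H) :=
  {p | ∃ hf : p.1 ∈ Q.domain, ∀ h : Q.domain, Q.toFun ⟨p.1, hf⟩ h = inner ℝ p.2 (h : H)}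

/-- `(P t)_{t ≥ 0}` is the strongly continuous semigroup whose generator is `-L`, where `L` is the
operator with graph `Γ`. -/
structure IsSemigroupOf {H : Type*} [NormedAddCommGroup H] [NormedSpace ℝ H]
    (Γ : Set (H × H)) (P : ℝ → H →L[ℝ] H) : Prop where
  map_zero : P 0 = ContinuousLinearMap.id ℝ H
  map_add : ∀ s t : ℝ, 0 ≤ s → 0 ≤ t → P (s + t) = (P s).comp (P t)
  strong_cont : ∀ f : H, Tendsto (fun s => P s f) (𝓝[>] 0) (𝓝 f)
  generator : ∀ f g : H,
    (f, g) ∈ Γ ↔ Tendsto (fun s : ℝ => s⁻¹ • (P s f - f)) (𝓝[>] 0) (𝓝 (-g))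

/-- The semigroup `e^{-tL}`, `t ≥ 0`, of the operator `L` coming from the form `Q`, that is, the
(unique) strongly continuous semigroup generated by `-L`. -/
def PartialForm.semigroup {H : Type*} [NormedAddCommGroup H] [InnerProductSpace ℝ H]
    (Q : PartialForm H) : ℝ → H →L[ℝ] H :=
  Classical.epsilon (fun P : ℝ → H →L[ℝ] H => IsSemigroupOf Q.operatorGraph P)

namespace GraphOver

variable {X : Type*} (G : GraphOver X)

/-- Any two vertices are joined by a path of edges of positive weight. -/
def Connected : Prop :=
  ∀ x y : X, Relation.ReflTransGen (fun u v => 0 < G.b u v) x y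

/-- The graph induced on the finite set `K` (with `b` restricted to `K × K`) is connected. -/
def ConnectedOn (K : Finset X) : Prop :=
  ∀ x y : K, Relation.ReflTransGen (fun u v : K => 0 < G.b u v) x y

/-- An exhaustion by an increasing sequence of finite sets inducing connected graphs. -/
structure IsExhaustion (K : ℕ → Finset X) : Prop where
  mono : ∀ k, K k ⊆ K (k + 1)
  exhaust : ∀ x, ∃ k, x ∈ K k
  connected : ∀ k, G.ConnectedOn (K k)

/-! ### The Hilbert space `ℓ²(X, m)` -/

theorem summable_mul_mul {ι : Type*} {w f g : ι → ℝ} (hw : ∀ i, 0 ≤ w i)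
    (hf : Summable fun i => w i * f i ^ 2) (hg : Summable fun i => w i * g i ^ 2) :
    Summable fun i => w i * (f i * g i) := by
  refine Summable.of_norm_bounded (hf.add hg) fun i => ?_
  rw [Real.norm_eq_abs, abs_mul, abs_of_nonneg (hw i), ← mul_add]
  refine mul_le_mul_of_nonneg_left ?_ (hw i)
  rw [abs_le]
  constructor <;> nlinarith [sq_nonneg (f i + g i), sq_nonneg (f i - g i), sq_nonneg (f i),
    sq_nonneg (g i)]

theorem summable_add_sq {ι : Type*} {w f g : ι → ℝ} (hw : ∀ i, 0 ≤ w i)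
    (hf : Summable fun i => w i * f i ^ 2) (hg : Summable fun i => w i * g i ^ 2) :
    Summable fun i => w i * (f i + g i) ^ 2 := by
  refine ((hf.add hg).add ((summable_mul_mul hw hf hg).mul_left 2)).congr fun i => ?_
  ring

theorem summable_smul_sq {ι : Type*} {w f : ι → ℝ} (a : ℝ)
    (hf : Summable fun i => w i * f i ^ 2) : Summable fun i => w i * (a * f i) ^ 2 := by
  refine (hf.mul_left (a ^ 2)).congr fun i => ?_
  ring

/-- `ℓ²(X, m)` as a space of functions. -/
def ell2Submodule : Submodule ℝ (X → ℝ) where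
  carrier := {f | Summable fun x => G.m x * f x ^ 2}
  add_mem' hf hg := summable_add_sq (fun x => (G.m_pos x).le) hf hg
  zero_mem' := by simp [summable_zero]
  smul_mem' a _ hf := summable_smul_sq a hf

/-- `ℓ²(X, m)`; it carries the topology of the norm `‖f‖² = ∑ m(x) f(x)²`
(and not that of pointwise convergence, hence the new type). -/
def Ell2 : Type _ := ↥G.ell2Submodule

namespace Ell2

variable {G}

instance : AddCommGroup G.Ell2 := inferInstanceAs (AddCommGroup ↥G.ell2Submodule)
instance : Module ℝ G.Ell2 := inferInstanceAs (Module ℝ ↥G.ell2Submodule)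
instance : CoeFun G.Ell2 (fun _ => X → ℝ) := ⟨fun f => f.1⟩

theorem summable (f : G.Ell2) : Summable fun x => G.m x * f x ^ 2 := f.2

theorem summable_mul (f g : G.Ell2) : Summable fun x => G.m x * (f x * g x) :=
  summable_mul_mul (fun x => (G.m_pos x).le) f.summable g.summable

theorem add_apply (f g : G.Ell2) (x : X) : (f + g) x = f x + g x := rfl
theorem smul_apply (a : ℝ) (f : G.Ell2) (x : X) : (a • f) x = a * f x := rfl

/-- The inner product `⟨f, g⟩ = ∑ m(x) f(x) g(x)`. -/
@[reducible]
def core : InnerProductSpace.Core ℝ G.Ell2 where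
  inner f g := ∑' x, G.m x * (f x * g x)
  conj_inner_symm f g := by
    simp only [conj_trivial]
    exact tsum_congr fun x => by ring
  re_inner_nonneg f := by
    simp only [RCLike.re_to_real]
    exact tsum_nonneg fun x => mul_nonneg (G.m_pos x).le (mul_self_nonneg _)
  add_left f g h := by
    rw [← (f.summable_mul h).tsum_add (g.summable_mul h)]
    exact tsum_congr fun x => by rw [add_apply]; ring
  smul_left f g a := by
    rw [conj_trivial, ← tsum_mul_left]
    exact tsum_congr fun x => by rw [smul_apply]; ring
  definite f hf := by
    refine Subtype.ext (funext fun x => ?_)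
    have h0 := (hasSum_zero_iff_of_nonneg
      (fun x => mul_nonneg (G.m_pos x).le (mul_self_nonneg (f x)))).1
      (hf ▸ (f.summable_mul f).hasSum)
    have hx : G.m x * (f x * f x) = 0 := congrFun h0 x
    exact mul_self_eq_zero.1 ((mul_eq_zero.1 hx).resolve_left (G.m_pos x).ne')

instance : NormedAddCommGroup G.Ell2 := (core (G := G)).toNormedAddCommGroup
instance : InnerProductSpace ℝ G.Ell2 := InnerProductSpace.ofCore core.toCore

/-- Membership in `C_c(X)`. -/
def FinitelySupported (f : G.Ell2) : Prop := (Function.support (f : X → ℝ)).Finite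

/-- Extension by zero of a function on a finite set. -/
def extendZero (K : Finset X) (g : K → ℝ) : G.Ell2 :=
  ⟨by
    classical
    exact fun x => if h : x ∈ K then g ⟨x, h⟩ else 0, by
    classical
    refine summable_of_hasFiniteSupport (K.finite_toSet.subset fun x hx => ?_)
    by_contra h
    exact hx (by simp [show x ∉ K from h])⟩

end Ell2

/-! ### The energy form and its Dirichlet and Neumann restrictions -/

/-- `f` has finite energy. -/
def FiniteEnergy (f : X → ℝ) : Prop :=
  Summable (fun p : X × X => G.b p.1 p.2 * (f p.1 - f p.2) ^ 2) ∧
    Summable (fun x => G.c x * f x ^ 2)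

/-- The energy form
`𝒬(f, g) = 1/2 ∑_{x,y} b(x,y) (f(x) - f(y)) (g(x) - g(y)) + ∑_x c(x) f(x) g(x)`. -/
def energy (f g : X → ℝ) : ℝ :=
  1 / 2 * ∑' p : X × X, G.b p.1 p.2 * ((f p.1 - f p.2) * (g p.1 - g p.2)) +
    ∑' x, G.c x * (f x * g x)

/-- `D(Q^{(N)}) = 𝒟 ∩ ℓ²(X, m)`. -/
def neumannDomain : Submodule ℝ G.Ell2 where
  carrier := {f | G.FiniteEnergy f}
  add_mem' {f g} hf hg := by
    refine ⟨(summable_add_sq (w := fun p : X × X => G.b p.1 p.2)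
      (f := fun p => f p.1 - f p.2) (g := fun p => g p.1 - g p.2)
      (fun p => G.b_nonneg p.1 p.2) hf.1 hg.1).congr fun p => ?_,
      summable_add_sq (w := G.c) (f := f) (g := g) G.c_nonneg hf.2 hg.2⟩
    rw [Ell2.add_apply, Ell2.add_apply]; ring
  zero_mem' := by
    have h : ∀ x, (0 : G.Ell2) x = 0 := fun _ => rfl
    constructor <;> simp [h, summable_zero]
  smul_mem' a f hf := by
    refine ⟨(summable_smul_sq (w := fun p : X × X => G.b p.1 p.2)
      (f := fun p => f p.1 - f p.2) a hf.1).congr fun p => ?_,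
      summable_smul_sq (w := G.c) (f := f) a hf.2⟩
    rw [Ell2.smul_apply, Ell2.smul_apply]; ring

/-- The square `‖f‖_𝒬² = 𝒬(f) + ‖f‖²` of the form norm. -/
def formNormSq (f : G.Ell2) : ℝ := G.energy f f + ‖f‖ ^ 2

theorem energy_self_nonneg (f : X → ℝ) : 0 ≤ G.energy f f :=
  add_nonneg (mul_nonneg (by norm_num)
    (tsum_nonneg fun p => mul_nonneg (G.b_nonneg _ _) (mul_self_nonneg _)))
    (tsum_nonneg fun x => mul_nonneg (G.c_nonneg x) (mul_self_nonneg _))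

theorem tsum_add_le {ι : Type*} {w f g : ι → ℝ} (hw : ∀ i, 0 ≤ w i)
    (hf : Summable fun i => w i * f i ^ 2) (hg : Summable fun i => w i * g i ^ 2) :
    ∑' i, w i * ((f i + g i) * (f i + g i)) ≤
      2 * ∑' i, w i * (f i * f i) + 2 * ∑' i, w i * (g i * g i) := by
  have hf' : Summable fun i => w i * (f i * f i) := by simpa only [sq] using hf
  have hg' : Summable fun i => w i * (g i * g i) := by simpa only [sq] using hg
  have hs : Summable fun i => w i * ((f i + g i) * (f i + g i)) := by
    simpa only [sq] using summable_add_sq hw hf hg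
  rw [← tsum_mul_left, ← tsum_mul_left, ← (hf'.mul_left 2).tsum_add (hg'.mul_left 2)]
  refine hs.tsum_le_tsum (fun i => ?_) ((hf'.mul_left 2).add (hg'.mul_left 2))
  nlinarith [mul_nonneg (hw i) (sq_nonneg (f i - g i))]

theorem formNormSq_add_le {f g : G.Ell2} (hf : f ∈ G.neumannDomain) (hg : g ∈ G.neumannDomain) :
    G.formNormSq (f + g) ≤ 2 * G.formNormSq f + 2 * G.formNormSq g := by
  have h1 := tsum_add_le (w := fun p : X × X => G.b p.1 p.2)
    (f := fun p => f p.1 - f p.2) (g := fun p => g p.1 - g p.2)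
    (fun p : X × X => G.b_nonneg p.1 p.2) hf.1 hg.1
  have h2 := tsum_add_le (w := G.c) (f := f) (g := g) G.c_nonneg hf.2 hg.2
  have h3 : ‖f + g‖ ^ 2 ≤ 2 * ‖f‖ ^ 2 + 2 * ‖g‖ ^ 2 := by
    nlinarith [norm_add_le f g, norm_nonneg (f + g), norm_nonneg f, norm_nonneg g,
      sq_nonneg (‖f‖ - ‖g‖)]
  have h4 : ∑' p : X × X, G.b p.1 p.2 *
      (((f + g) p.1 - (f + g) p.2) * ((f + g) p.1 - (f + g) p.2)) =
      ∑' p : X × X, G.b p.1 p.2 *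
        (((f p.1 - f p.2) + (g p.1 - g p.2)) * ((f p.1 - f p.2) + (g p.1 - g p.2))) :=
    tsum_congr fun p => by rw [Ell2.add_apply, Ell2.add_apply]; ring
  have h5 : ∑' x, G.c x * ((f + g) x * (f + g) x) =
      ∑' x, G.c x * ((f x + g x) * (f x + g x)) := rfl
  unfold formNormSq energy
  rw [h4, h5]
  linarith

theorem formNormSq_smul (a : ℝ) (f : G.Ell2) :
    G.formNormSq (a • f) = a ^ 2 * G.formNormSq f := by
  have h4 : ∑' p : X × X, G.b p.1 p.2 * (((a • f) p.1 - (a • f) p.2) *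
      ((a • f) p.1 - (a • f) p.2)) =
      a ^ 2 * ∑' p : X × X, G.b p.1 p.2 * ((f p.1 - f p.2) * (f p.1 - f p.2)) := by
    rw [← tsum_mul_left]
    exact tsum_congr fun p => by rw [Ell2.smul_apply, Ell2.smul_apply]; ring
  have h5 : ∑' x, G.c x * ((a • f) x * (a • f) x) = a ^ 2 * ∑' x, G.c x * (f x * f x) := by
    rw [← tsum_mul_left]
    exact tsum_congr fun x => by rw [Ell2.smul_apply]; ring
  unfold formNormSq energy
  rw [h4, h5, norm_smul, mul_pow, Real.norm_eq_abs, sq_abs]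
  ring

theorem finitelySupported_mem_neumannDomain {f : G.Ell2} (hf : f.FinitelySupported) :
    f ∈ G.neumannDomain := by
  refine ⟨?_, summable_of_hasFiniteSupport (hf.subset fun x hx h => hx (by simp [h]))⟩
  have key : Summable fun p : X × X => G.b p.1 p.2 * f p.1 ^ 2 := by
    rw [summable_prod_of_nonneg (fun p => mul_nonneg (G.b_nonneg _ _) (sq_nonneg _))]
    constructor
    · intro x
      exact (G.b_summable x).mul_right (f x ^ 2)
    · refine summable_of_hasFiniteSupport (hf.subset fun x hx h => hx ?_)
      change ∑' y, G.b x y * f x ^ 2 = 0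
      simp [h]
  have key' : Summable fun p : X × X => G.b p.1 p.2 * (-f p.2) ^ 2 :=
    ((Equiv.prodComm X X).summable_iff.2 key).congr fun p => by
      simp [G.b_symm p.2 p.1]
  exact (summable_add_sq (w := fun p : X × X => G.b p.1 p.2) (f := fun p => f p.1)
    (g := fun p => -f p.2) (fun p => G.b_nonneg p.1 p.2) key key').congr fun p => by ring

/-- `D(Q^{(D)})`, the closure of `C_c(X)` in `(𝒟 ∩ ℓ²(X, m), ‖·‖_𝒬)`. -/
def dirichletDomain : Submodule ℝ G.Ell2 where
  carrier := {f | f ∈ G.neumannDomain ∧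
    ∀ ε > 0, ∃ φ : G.Ell2, φ.FinitelySupported ∧ G.formNormSq (f - φ) < ε}
  add_mem' {f g} hf hg := by
    refine ⟨add_mem hf.1 hg.1, fun ε hε => ?_⟩
    obtain ⟨φ, hφ, h1⟩ := hf.2 (ε / 4) (by positivity)
    obtain ⟨ψ, hψ, h2⟩ := hg.2 (ε / 4) (by positivity)
    refine ⟨φ + ψ, (hφ.union hψ).subset (Function.support_add _ _), ?_⟩
    have := G.formNormSq_add_le
      (sub_mem hf.1 (G.finitelySupported_mem_neumannDomain hφ))
      (sub_mem hg.1 (G.finitelySupported_mem_neumannDomain hψ))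
    rw [add_sub_add_comm]
    linarith
  zero_mem' := by
    refine ⟨zero_mem _, fun ε hε => ⟨0, ?_, ?_⟩⟩
    · have h : ∀ x, (0 : G.Ell2) x = 0 := fun _ => rfl
      simp [Ell2.FinitelySupported, Function.support, h]
    · have h := G.formNormSq_smul 0 0
      rw [zero_smul] at h
      rw [sub_zero, h]
      simpa using hε
  smul_mem' a f hf := by
    refine ⟨Submodule.smul_mem _ a hf.1, fun ε hε => ?_⟩
    obtain ⟨φ, hφ, h1⟩ := hf.2 (ε / (a ^ 2 + 1)) (by positivity)
    refine ⟨a • φ, hφ.subset fun x hx h => hx ?_, ?_⟩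
    · change a * φ x = 0
      rw [h, mul_zero]
    · rw [← smul_sub, formNormSq_smul]
      rw [lt_div_iff₀ (by positivity)] at h1
      have : 0 ≤ G.formNormSq (f - φ) := add_nonneg (G.energy_self_nonneg _) (sq_nonneg _)
      nlinarith

/-- The Neumann form `Q^{(N)}`. -/
def neumannForm : PartialForm G.Ell2 := ⟨G.neumannDomain, fun f g => G.energy f.1 g.1⟩

/-- The Dirichlet form `Q^{(D)}`. -/
def dirichletForm : PartialForm G.Ell2 := ⟨G.dirichletDomain, fun f g => G.energy f.1 g.1⟩

/-- The Dirichlet semigroup `P_t^{(D)} = e^{-tL^{(D)}}` on `ℓ²(X, m)`, for `t ≥ 0`. -/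
def dirichletSemigroup (t : ℝ) : G.Ell2 →L[ℝ] G.Ell2 := G.dirichletForm.semigroup t

/-! ### Neumann restrictions to finite sets -/

/-- The Neumann restriction of the Laplacian to the finite set `K`. -/
def restrictedLaplacian (K : Finset X) : (K → ℝ) →ₗ[ℝ] (K → ℝ) where
  toFun f x := 1 / G.m x * ∑ y : K, G.b x y * (f x - f y) + G.c x / G.m x * f x
  map_add' f g := by
    funext x
    have : ∑ y : K, G.b x y * ((f + g) x - (f + g) y) =
        ∑ y : K, G.b x y * (f x - f y) + ∑ y : K, G.b x y * (g x - g y) := by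
      rw [← Finset.sum_add_distrib]
      exact Finset.sum_congr rfl fun y _ => by simp only [Pi.add_apply]; ring
    rw [this]
    simp only [Pi.add_apply]
    ring
  map_smul' a f := by
    funext x
    have : ∑ y : K, G.b x y * ((a • f) x - (a • f) y) =
        a * ∑ y : K, G.b x y * (f x - f y) := by
      rw [Finset.mul_sum]
      exact Finset.sum_congr rfl fun y _ => by simp only [Pi.smul_apply, smul_eq_mul]; ring
    rw [this]
    simp only [Pi.smul_apply, smul_eq_mul, RingHom.id_apply]
    ring

/-- The Neumann restriction of the semigroup to the finite set `K`, regarded as acting on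
`ℓ²(X, m)`: restrict to `K`, apply `exp (-t L_K^{(N)})`, and extend by zero. -/
def restrictedSemigroup (K : Finset X) (t : ℝ) (f : G.Ell2) : G.Ell2 :=
  Ell2.extendZero K
    (NormedSpace.exp (-t • LinearMap.toContinuousLinearMap (G.restrictedLaplacian K))
      (fun x : K => f x))

end GraphOver

end

/-! The Neumann restrictions always converge strongly, and their limit is the semigroup `P^N` of the
Neumann form (`tendsto_restrictedSemigroup`). So (ii), (iii) and (iv) only say where `P^N_t` and the
Dirichlet semigroup `P^D_t` agree. The implications (i) ⇒ (ii) ⇒ (iv) ⇒ (iii) are then immediate,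
and the content of (iii) ⇒ (i) is that agreement on one nonzero function of constant sign forces
equality of the forms.

For that, let `φ ≥ 0` and `P^N_t φ = P^D_t φ`. Domination `0 ≤ P^D ≤ P^N` on nonnegative functions
(`dirichlet_nonneg_and_le_neumann`) together with injectivity of `P^N` propagates the agreement to
all times `s ≤ t` (`neumann_apply_eq_of_le`). Hence `P^N_r` and `P^D_r` agree on `v = P^D_{t/2} φ`
for `r ≤ t/2`. Since the graph is connected, `v` is strictly positive (`dirichlet_pos`), so it
dominates a positive multiple of each delta function. Domination then gives agreement on delta
functions, and symmetry gives it everywhere (`semigroup_eq_of_apply_eq`). Agreement for small times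
identifies the generators, hence the resolvents, hence the forms
(`dirichletForm_eq_of_operatorGraph_eq`).

The analytic input is obtained from finite-dimensional approximation. The map `f ↦ (f, ∇f, √c f)`
identifies each form with a closed subspace `F` of a Hilbert space; with `j` the first coordinate,
the resolvent at `-1` is `j P_F j*` by Riesz (`Represents.mem_operatorGraph_iff`). Dirichlet
resolvents on finite sets converge because projections onto increasing subspaces do; Neumann
resolvents converge by a monotone variational argument (`tendsto_neumann_resolvent`). Weierstrass
approximation in the variable `(1 + x)⁻¹` upgrades this to convergence of the heat operators, whose
limit has the right generator (`heatLimit_isSemigroupOf`). Uniqueness of the semigroup of a densely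
defined accretive operator identifies that limit with the semigroup of the form. -/

noncomputable section

/-! ### Functional calculus of finite spectral data and strong convergence -/

/-- A finite orthonormal family together with nonnegative eigenvalues. -/
structure FiniteSpectralData (H : Type*) [NormedAddCommGroup H] [InnerProductSpace ℝ H] where
  n : ℕ
  vec : Fin n → H
  eig : Fin n → ℝ
  orthonormal : Orthonormal ℝ vec
  eig_nonneg : ∀ i, 0 ≤ eig i

namespace FiniteSpectralData

variable {H : Type*} [NormedAddCommGroup H] [InnerProductSpace ℝ H]

/-- The function `φ` of the operator described by `S`, vanishing on the orthogonal complement of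
the eigenvectors. -/
def apply (S : FiniteSpectralData H) (φ : ℝ → ℝ) : H →L[ℝ] H :=
  ∑ i, φ (S.eig i) • (innerSL ℝ (S.vec i)).smulRight (S.vec i)

theorem apply_apply (S : FiniteSpectralData H) (φ : ℝ → ℝ) (g : H) :
    S.apply φ g = ∑ i, (φ (S.eig i) * inner ℝ (S.vec i) g) • S.vec i := by
  simp [apply, smul_smul]

theorem inner_vec_apply (S : FiniteSpectralData H) (φ : ℝ → ℝ) (g : H) (i : Fin S.n) :
    inner ℝ (S.vec i) (S.apply φ g) = φ (S.eig i) * inner ℝ (S.vec i) g := by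
  rw [apply_apply]
  exact S.orthonormal.inner_right_fintype _ _

theorem apply_congr (S : FiniteSpectralData H) {φ ψ : ℝ → ℝ} (h : ∀ x, 0 ≤ x → φ x = ψ x) :
    S.apply φ = S.apply ψ := by
  ext g
  simp only [apply_apply]
  exact Finset.sum_congr rfl fun i _ => by rw [h _ (S.eig_nonneg i)]

theorem apply_mul (S : FiniteSpectralData H) (φ ψ : ℝ → ℝ) (g : H) :
    S.apply (fun x => φ x * ψ x) g = S.apply φ (S.apply ψ g) := by
  rw [apply_apply S φ, apply_apply]
  exact Finset.sum_congr rfl fun i _ => by rw [inner_vec_apply, mul_assoc]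

theorem apply_add (S : FiniteSpectralData H) (φ ψ : ℝ → ℝ) (g : H) :
    S.apply (fun x => φ x + ψ x) g = S.apply φ g + S.apply ψ g := by
  simp only [apply_apply, add_mul, add_smul, Finset.sum_add_distrib]

theorem apply_sub (S : FiniteSpectralData H) (φ ψ : ℝ → ℝ) (g : H) :
    S.apply (fun x => φ x - ψ x) g = S.apply φ g - S.apply ψ g := by
  simp only [apply_apply, sub_mul, sub_smul, Finset.sum_sub_distrib]

theorem apply_const_mul (S : FiniteSpectralData H) (a : ℝ) (φ : ℝ → ℝ) (g : H) :
    S.apply (fun x => a * φ x) g = a • S.apply φ g := by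
  simp only [apply_apply, Finset.smul_sum, smul_smul, mul_assoc]

theorem inner_apply_left (S : FiniteSpectralData H) (φ : ℝ → ℝ) (f g : H) :
    inner ℝ (S.apply φ f) g = inner ℝ f (S.apply φ g) := by
  simp only [apply_apply, sum_inner, inner_sum, inner_smul_left, inner_smul_right, conj_trivial]
  refine Finset.sum_congr rfl fun i _ => ?_
  rw [real_inner_comm f]
  ring

/-- Bessel's inequality suffices, as the eigenvectors need not span `H`. The bound is independent of
`S`, hence uniform along a sequence. -/
theorem norm_apply_le (S : FiniteSpectralData H) {φ : ℝ → ℝ} {C : ℝ}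
    (h : ∀ x, 0 ≤ x → |φ x| ≤ C) (hC : 0 ≤ C) (g : H) : ‖S.apply φ g‖ ≤ C * ‖g‖ := by
  refine le_of_sq_le_sq ?_ (by positivity)
  rw [mul_pow, ← real_inner_self_eq_norm_sq, apply_apply, S.orthonormal.inner_sum]
  refine le_trans ?_ (mul_le_mul_of_nonneg_left
    (S.orthonormal.sum_inner_products_le g (s := Finset.univ)) (sq_nonneg C))
  rw [Finset.mul_sum]
  refine Finset.sum_le_sum fun i _ => ?_
  rw [conj_trivial, Real.norm_eq_abs, sq_abs]
  have h1 := sq_le_sq' (abs_le.1 (h _ (S.eig_nonneg i))).1 (abs_le.1 (h _ (S.eig_nonneg i))).2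
  nlinarith [mul_le_mul_of_nonneg_right h1 (sq_nonneg (inner ℝ (S.vec i) g))]

/-- The operators `φ(S k)` converge strongly. -/
def Converges (S : ℕ → FiniteSpectralData H) (φ : ℝ → ℝ) : Prop :=
  ∀ g, ∃ l, Tendsto (fun k => (S k).apply φ g) atTop (𝓝 l)

theorem tendsto_apply_apply {S : ℕ → FiniteSpectralData H} {φ : ℝ → ℝ} {C : ℝ}
    (hφ : ∀ x, 0 ≤ x → |φ x| ≤ C) (hC : 0 ≤ C) {u : ℕ → H} {l l' : H}
    (hu : Tendsto u atTop (𝓝 l)) (hl : Tendsto (fun k => (S k).apply φ l) atTop (𝓝 l')) :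
    Tendsto (fun k => (S k).apply φ (u k)) atTop (𝓝 l') := by
  have h : Tendsto (fun k => (S k).apply φ (u k - l)) atTop (𝓝 0) := by
    refine squeeze_zero_norm (fun k => (S k).norm_apply_le hφ hC (u k - l)) ?_
    have := (tendsto_iff_norm_sub_tendsto_zero.1 hu).const_mul C
    simpa using this
  simpa using h.add hl

theorem Converges.mul {S : ℕ → FiniteSpectralData H} {φ ψ : ℝ → ℝ} {C : ℝ}
    (hφ : Converges S φ) (hψ : Converges S ψ) (hC : ∀ x, 0 ≤ x → |φ x| ≤ C) :
    Converges S (fun x => φ x * ψ x) := by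
  intro g
  obtain ⟨l, hl⟩ := hψ g
  obtain ⟨l', hl'⟩ := hφ l
  refine ⟨l', ?_⟩
  simp only [apply_mul]
  exact tendsto_apply_apply hC ((abs_nonneg _).trans (hC 0 le_rfl)) hl hl'

theorem Converges.add {S : ℕ → FiniteSpectralData H} {φ ψ : ℝ → ℝ}
    (hφ : Converges S φ) (hψ : Converges S ψ) : Converges S (fun x => φ x + ψ x) := by
  intro g
  obtain ⟨l, hl⟩ := hφ g
  obtain ⟨l', hl'⟩ := hψ g
  exact ⟨l + l', by simpa only [apply_add] using hl.add hl'⟩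

theorem Converges.const_mul {S : ℕ → FiniteSpectralData H} {φ : ℝ → ℝ} (a : ℝ)
    (hφ : Converges S φ) : Converges S (fun x => a * φ x) := by
  intro g
  obtain ⟨l, hl⟩ := hφ g
  exact ⟨a • l, by simpa only [apply_const_mul] using hl.const_smul a⟩

theorem Converges.of_approx [CompleteSpace H] {S : ℕ → FiniteSpectralData H} {φ : ℝ → ℝ}
    (h : ∀ ε > 0, ∃ ψ, Converges S ψ ∧ ∀ x, 0 ≤ x → |φ x - ψ x| ≤ ε) : Converges S φ := by
  intro g
  refine cauchySeq_tendsto_of_complete (Metric.cauchySeq_iff'.2 fun ε hε => ?_)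
  -- Chosen so that `δ ‖g‖ ≤ ε / 4`; the `+ 1` covers `g = 0`.
  set δ := ε / (4 * (‖g‖ + 1)) with hδ
  have hδ0 : 0 < δ := by positivity
  have hδg : δ * ‖g‖ ≤ ε / 4 := by
    rw [hδ, div_mul_eq_mul_div, div_le_div_iff₀ (by positivity) (by norm_num)]
    nlinarith [norm_nonneg g]
  obtain ⟨ψ, hψ, hd⟩ := h δ hδ0
  obtain ⟨l, hl⟩ := hψ g
  obtain ⟨N, hN⟩ := Metric.cauchySeq_iff'.1 hl.cauchySeq (ε / 4) (by positivity)
  refine ⟨N, fun n hn => ?_⟩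
  have hb : ∀ k, dist ((S k).apply φ g) ((S k).apply ψ g) ≤ ε / 4 := fun k => by
    rw [dist_eq_norm, ← apply_sub]
    exact ((S k).norm_apply_le hd hδ0.le g).trans hδg
  have h1 := dist_triangle4 ((S n).apply φ g) ((S n).apply ψ g) ((S N).apply ψ g)
    ((S N).apply φ g)
  have h2 := hb N
  rw [dist_comm] at h2
  linarith [hb n, hN n hn]

/-- The function `x ↦ (1 + x)⁻¹` giving the resolvent at `-1`. -/
def resolventFun (x : ℝ) : ℝ := (1 + x)⁻¹

theorem resolventFun_mem {x : ℝ} (hx : 0 ≤ x) : resolventFun x ∈ Set.Icc (0 : ℝ) 1 :=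
  ⟨by unfold resolventFun; positivity, inv_le_one_of_one_le₀ (by linarith)⟩

theorem abs_resolventFun_le {x : ℝ} (hx : 0 ≤ x) : |resolventFun x| ≤ 1 := by
  rw [abs_of_nonneg (resolventFun_mem hx).1]
  exact (resolventFun_mem hx).2

/-- If a uniformly bounded family of operators converges on a dense set, it converges everywhere. -/
theorem tendsto_of_dense_of_norm_le {α : Type*} {l : Filter α} {T : α → H →L[ℝ] H}
    {B : H →L[ℝ] H} {C : ℝ} (hT : ∀ᶠ a in l, ∀ g, ‖T a g‖ ≤ C * ‖g‖) {s : Set H} (hs : Dense s)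
    (h : ∀ g ∈ s, Tendsto (fun a => T a g) l (𝓝 (B g))) (g : H) :
    Tendsto (fun a => T a g) l (𝓝 (B g)) := by
  rw [Metric.tendsto_nhds]
  intro ε hε
  set M := |C| + ‖B‖ + 1 with hM
  have hM0 : 0 < M := by positivity
  obtain ⟨f, hf, hfg⟩ := Metric.dense_iff.1 hs g (ε / (4 * M)) (by positivity)
  have hfg' : M * ‖g - f‖ ≤ ε / 4 := by
    rw [Metric.mem_ball, dist_comm, dist_eq_norm, lt_div_iff₀ (by positivity)] at hf
    linarith
  filter_upwards [hT, Metric.tendsto_nhds.1 (h f hfg) (ε / 4) (by positivity)] with a ha hb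
  have h1 : T a g - B g = T a (g - f) - B (g - f) + (T a f - B f) := by
    simp only [map_sub]; abel
  rw [dist_eq_norm] at hb ⊢
  rw [h1]
  have h2 := norm_add_le (T a (g - f) - B (g - f)) (T a f - B f)
  have h3 := norm_sub_le (T a (g - f)) (B (g - f))
  have h4 := ha (g - f)
  have h5 := B.le_opNorm (g - f)
  have h6 : C * ‖g - f‖ ≤ M * ‖g - f‖ :=
    mul_le_mul_of_nonneg_right (by rw [hM]; linarith [le_abs_self C, norm_nonneg B])
      (norm_nonneg _)
  have h7 : ‖B‖ * ‖g - f‖ ≤ M * ‖g - f‖ :=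
    mul_le_mul_of_nonneg_right (by rw [hM]; linarith [abs_nonneg C]) (norm_nonneg _)
  linarith

section Limit

variable {S : ℕ → FiniteSpectralData H} {R : H →L[ℝ] H}

theorem resolvent_symmetric
    (hR : ∀ g, Tendsto (fun k => (S k).apply resolventFun g) atTop (𝓝 (R g))) (f g : H) :
    inner ℝ (R f) g = inner ℝ f (R g) := by
  refine tendsto_nhds_unique ((hR f).inner tendsto_const_nhds) ?_
  simp only [inner_apply_left]
  exact tendsto_const_nhds.inner (hR g)

/-- As a limit of symmetric operators `R` is symmetric, so the orthogonal complement of its range is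
its kernel. -/
theorem dense_range_resolvent [CompleteSpace H]
    (hR : ∀ g, Tendsto (fun k => (S k).apply resolventFun g) atTop (𝓝 (R g)))
    (hinj : ∀ g, R g = 0 → g = 0) : Dense (Set.range R) := by
  have h : (LinearMap.range (R : H →ₗ[ℝ] H)).topologicalClosure = ⊤ := by
    rw [Submodule.topologicalClosure_eq_top_iff, Submodule.eq_bot_iff]
    intro g hg
    refine hinj g (ext_inner_left ℝ fun f => ?_)
    rw [inner_zero_right, ← resolvent_symmetric hR]
    exact (Submodule.mem_orthogonal _ _).1 hg _ ⟨f, rfl⟩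
  have h2 := Submodule.dense_iff_topologicalClosure_eq_top.2 h
  rwa [LinearMap.coe_range] at h2

/-- The constant `1` gives the projection onto the span of the eigenvectors, which fixes the
approximating resolvents. It therefore tends to the identity on the range of `R`, which is dense. -/
theorem tendsto_apply_one [CompleteSpace H]
    (hR : ∀ g, Tendsto (fun k => (S k).apply resolventFun g) atTop (𝓝 (R g)))
    (hinj : ∀ g, R g = 0 → g = 0) (g : H) :
    Tendsto (fun k => (S k).apply (fun _ => 1) g) atTop (𝓝 g) := by
  have hb : ∀ k g, ‖(S k).apply (fun _ => 1) g‖ ≤ 1 * ‖g‖ := fun k g =>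
    (S k).norm_apply_le (fun x _ => by simp) zero_le_one g
  refine tendsto_of_dense_of_norm_le (B := ContinuousLinearMap.id ℝ H)
    (Eventually.of_forall hb) (dense_range_resolvent hR hinj) ?_ g
  rintro _ ⟨h, rfl⟩
  have h1 : Tendsto (fun k => (S k).apply (fun _ => 1) (R h - (S k).apply resolventFun h)) atTop
      (𝓝 0) := by
    refine squeeze_zero_norm (fun k => hb k _) ?_
    have := (tendsto_const_nhds (x := R h)).sub (hR h)
    simpa using this.norm
  have h2 := h1.add (hR h)
  rw [zero_add] at h2
  refine h2.congr fun k => ?_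
  rw [map_sub, ← apply_mul]
  simp

theorem converges_polynomial [CompleteSpace H]
    (hR : ∀ g, Tendsto (fun k => (S k).apply resolventFun g) atTop (𝓝 (R g)))
    (hinj : ∀ g, R g = 0 → g = 0) (p : Polynomial ℝ) :
    Converges S (fun x => p.eval (resolventFun x)) := by
  have hpow : ∀ n : ℕ, Converges S (fun x => resolventFun x ^ n) := by
    intro n
    induction n with
    | zero => intro g; exact ⟨g, by simpa using tendsto_apply_one hR hinj g⟩
    | succ n ih =>
      have h := Converges.mul (S := S) (φ := resolventFun) (fun g => ⟨_, hR g⟩) ih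
        (fun x hx => abs_resolventFun_le hx)
      simpa only [pow_succ'] using h
  induction p using Polynomial.induction_on' with
  | add p q hp hq => simpa only [Polynomial.eval_add] using hp.add hq
  | monomial n a => simpa only [Polynomial.eval_monomial] using (hpow n).const_mul a

/-- Weierstrass approximation on `[0, 1]`, where `resolventFun` takes its values. Continuity of `f`
at `0` is a condition on `φ` at infinity. -/
theorem converges_of_continuousOn [CompleteSpace H]
    (hR : ∀ g, Tendsto (fun k => (S k).apply resolventFun g) atTop (𝓝 (R g)))
    (hinj : ∀ g, R g = 0 → g = 0) {f φ : ℝ → ℝ} (hf : ContinuousOn f (Set.Icc 0 1))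
    (hφ : ∀ x, 0 ≤ x → φ x = f (resolventFun x)) : Converges S φ := by
  refine Converges.of_approx fun ε hε => ?_
  obtain ⟨p, hp⟩ := exists_polynomial_near_of_continuousOn 0 1 f hf ε hε
  refine ⟨_, converges_polynomial hR hinj p, fun x hx => ?_⟩
  rw [hφ x hx, abs_sub_comm]
  exact (hp _ (resolventFun_mem hx)).le

end Limit

end FiniteSpectralData

/-! ### The limit of the heat operators and its generator -/

namespace FiniteSpectralData

variable {H : Type*} [NormedAddCommGroup H] [InnerProductSpace ℝ H]

/-- With `u = (1 + x)⁻¹` this is `(1 + x)^n e^{-tx}` up to the factor `e^t`. Continuity at `u = 0`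
is the decay of the exponential against powers. -/
theorem continuousOn_inv_pow_mul_exp (n : ℕ) {t : ℝ} (ht : 0 < t) :
    ContinuousOn (fun u : ℝ => if u = 0 then 0 else u⁻¹ ^ n * Real.exp (-(t * u⁻¹)))
      (Set.Icc 0 1) := by
  intro u hu
  rcases hu.1.eq_or_lt with rfl | h0
  · rw [← continuousWithinAt_sdiff_self, ContinuousWithinAt, if_pos rfl]
    have h1 : Tendsto (fun y : ℝ => y ^ n * Real.exp (-(t * y))) atTop (𝓝 0) := by
      have h := ((Real.tendsto_pow_mul_exp_neg_atTop_nhds_zero n).comp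
        (tendsto_id.const_mul_atTop ht)).const_mul ((t ^ n)⁻¹)
      rw [mul_zero] at h
      refine h.congr fun y => ?_
      simp only [Function.comp, id]
      rw [mul_pow, ← mul_assoc, ← mul_assoc, inv_mul_cancel₀ (by positivity), one_mul]
    have h2 : 𝓝[Set.Icc (0 : ℝ) 1 \ {0}] 0 ≤ 𝓝[>] 0 :=
      nhdsWithin_mono _ fun x hx => lt_of_le_of_ne hx.1.1 (Ne.symm hx.2)
    refine ((h1.comp tendsto_inv_nhdsGT_zero).mono_left h2).congr' ?_
    filter_upwards [self_mem_nhdsWithin] with x hx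
    rw [if_neg (show x ≠ 0 from hx.2)]
    rfl
  · refine ContinuousAt.continuousWithinAt ?_
    have : ContinuousAt (fun u : ℝ => u⁻¹ ^ n * Real.exp (-(t * u⁻¹))) u := by
      have := continuousAt_inv₀ h0.ne'
      fun_prop
    refine this.congr ?_
    filter_upwards [eventually_ne_nhds h0.ne'] with x hx
    rw [if_neg hx]

/-- The function `x ↦ e^{-tx}`. -/
def heatFun (t x : ℝ) : ℝ := Real.exp (-(t * x))

theorem abs_heatFun_le {t x : ℝ} (ht : 0 ≤ t) (hx : 0 ≤ x) : |heatFun t x| ≤ 1 := by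
  rw [heatFun, Real.abs_exp, Real.exp_le_one_iff]
  nlinarith [mul_nonneg ht hx]

theorem abs_heatFun_sub_one_le {t x : ℝ} (ht : 0 ≤ t) (hx : 0 ≤ x) : |heatFun t x - 1| ≤ t * x := by
  have h := (abs_le.1 (abs_heatFun_le ht hx)).2
  have h2 := Real.add_one_le_exp (-(t * x))
  rw [abs_sub_comm, abs_of_nonneg (by linarith), heatFun]
  linarith

theorem abs_heatFun_sub_one_add_le {t x : ℝ} (ht : 0 ≤ t) (hx : 0 ≤ x) :
    |heatFun t x - 1 + t * x| ≤ (t * x) ^ 2 := by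
  have htx := mul_nonneg ht hx
  have h2 := Real.add_one_le_exp (-(t * x))
  have h3 := Real.add_one_le_exp (t * x)
  have h4 : Real.exp (-(t * x)) * Real.exp (t * x) = 1 := by rw [← Real.exp_add]; simp
  have h5 := Real.exp_pos (-(t * x))
  rw [heatFun, abs_of_nonneg (by linarith)]
  have h6 : Real.exp (-(t * x)) * (1 + t * x) ≤ 1 := by nlinarith
  -- With `y = tx`, the negation reads `e^{-y} > 1 - y + y²`. Multiplied by `1 + y` it gives
  -- `e^{-y}(1 + y) > 1 + y³ ≥ 1`, against `h6`.
  by_contra! hc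
  nlinarith [pow_nonneg htx 3]

section Limit

variable {S : ℕ → FiniteSpectralData H} {R : H →L[ℝ] H} {P : ℝ → H →L[ℝ] H}

/-- The case `n = 0` produces the heat operators, the case `n = 1` shows that they map into the
range of the resolvent. -/
theorem converges_heatFun_mul_pow [CompleteSpace H]
    (hR : ∀ g, Tendsto (fun k => (S k).apply resolventFun g) atTop (𝓝 (R g)))
    (hinj : ∀ g, R g = 0 → g = 0) (n : ℕ) {t : ℝ} (ht : 0 < t) :
    Converges S (fun x => (1 + x) ^ n * heatFun t x) := by
  refine converges_of_continuousOn hR hinj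
    ((continuousOn_inv_pow_mul_exp n ht).const_mul (Real.exp t)) fun x hx => ?_
  have h1 : (1 + x)⁻¹ ≠ 0 := by positivity
  rw [resolventFun, if_neg h1, inv_inv, heatFun, mul_left_comm, ← Real.exp_add]
  congr 2
  ring

theorem exists_heatLimit [CompleteSpace H]
    (hR : ∀ g, Tendsto (fun k => (S k).apply resolventFun g) atTop (𝓝 (R g)))
    (hinj : ∀ g, R g = 0 → g = 0) :
    ∃ P : ℝ → H →L[ℝ] H, ∀ t, 0 ≤ t → ∀ g,
      Tendsto (fun k => (S k).apply (heatFun t) g) atTop (𝓝 (P t g)) := by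
  have h : ∀ t : ℝ, ∃ T : H →L[ℝ] H, 0 ≤ t → ∀ g,
      Tendsto (fun k => (S k).apply (heatFun t) g) atTop (𝓝 (T g)) := by
    intro t
    -- Nothing is claimed for `t < 0`. The case `t = 0` is separate because `e^{-tx}` then does not
    -- decay.
    rcases lt_trichotomy t 0 with ht | rfl | ht
    · exact ⟨0, fun h => absurd h ht.not_ge⟩
    · refine ⟨ContinuousLinearMap.id ℝ H, fun _ g => ?_⟩
      refine (tendsto_apply_one hR hinj g).congr fun k => ?_
      rw [(S k).apply_congr (φ := fun _ => 1) (ψ := heatFun 0) fun x _ => by simp [heatFun]]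
    · have hc := converges_heatFun_mul_pow hR hinj 0 ht
      simp only [pow_zero, one_mul] at hc
      choose T hT using hc
      exact ⟨continuousLinearMapOfTendsto (fun k => (S k).apply (heatFun t))
        (tendsto_pi_nhds.2 hT), fun _ g => hT g⟩
  choose P hP using h
  exact ⟨P, hP⟩

variable (hP : ∀ t, 0 ≤ t → ∀ g,
  Tendsto (fun k => (S k).apply (heatFun t) g) atTop (𝓝 (P t g)))
include hP

theorem heatLimit_norm_le {t : ℝ} (ht : 0 ≤ t) (g : H) : ‖P t g‖ ≤ ‖g‖ := by
  refine le_of_tendsto (hP t ht g).norm (Eventually.of_forall fun k => ?_)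
  simpa using (S k).norm_apply_le (fun x hx => abs_heatFun_le ht hx) zero_le_one g

theorem heatLimit_symmetric {t : ℝ} (ht : 0 ≤ t) (f g : H) :
    inner ℝ (P t f) g = inner ℝ f (P t g) := by
  refine tendsto_nhds_unique ((hP t ht f).inner tendsto_const_nhds) ?_
  simp only [inner_apply_left]
  exact tendsto_const_nhds.inner (hP t ht g)

theorem heatLimit_add {s t : ℝ} (hs : 0 ≤ s) (ht : 0 ≤ t) (g : H) :
    P (s + t) g = P s (P t g) := by
  refine tendsto_nhds_unique (hP (s + t) (add_nonneg hs ht) g) ?_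
  refine (tendsto_apply_apply (fun x hx => abs_heatFun_le hs hx) zero_le_one (hP t ht g)
    (hP s hs _)).congr fun k => ?_
  rw [← apply_mul, (S k).apply_congr fun x _ => ?_]
  rw [heatFun, heatFun, heatFun, ← Real.exp_add]
  congr 1
  ring

variable (hR : ∀ g, Tendsto (fun k => (S k).apply resolventFun g) atTop (𝓝 (R g)))
include hR

/-- The scalar bound `|e^{-tx} - 1| / (1 + x) ≤ t` for the approximants survives the limit. -/
theorem heatLimit_resolvent_sub_le {t : ℝ} (ht : 0 ≤ t) (h : H) :
    ‖P t (R h) - R h‖ ≤ t * ‖h‖ := by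
  have h1 := tendsto_apply_apply (fun x hx => abs_heatFun_le ht hx) zero_le_one (hR h) (hP t ht _)
  refine le_of_tendsto (h1.sub (hR h)).norm (Eventually.of_forall fun k => ?_)
  rw [← apply_mul, ← apply_sub]
  refine (S k).norm_apply_le (fun x hx => ?_) ht h
  rw [← sub_one_mul, abs_mul, abs_of_nonneg (resolventFun_mem hx).1, resolventFun, ← div_eq_mul_inv,
    div_le_iff₀ (by positivity)]
  nlinarith [abs_heatFun_sub_one_le ht hx]

/-- Two resolvents pay for a second-order Taylor estimate: `|e^{-tx} - 1 + tx| / (1 + x)² ≤ t²`. -/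
theorem heatLimit_resolvent_resolvent_sub_le {t : ℝ} (ht : 0 ≤ t) (h : H) :
    ‖P t (R (R h)) - R (R h) + t • (R h - R (R h))‖ ≤ t ^ 2 * ‖h‖ := by
  have h0 := tendsto_apply_apply (fun x hx => abs_resolventFun_le hx) zero_le_one (hR h) (hR _)
  have h1 := tendsto_apply_apply (fun x hx => abs_heatFun_le ht hx) zero_le_one h0 (hP t ht _)
  refine le_of_tendsto ((h1.sub h0).add (((hR h).sub h0).const_smul t)).norm
    (Eventually.of_forall fun k => ?_)
  simp only [← apply_mul, ← apply_sub, ← apply_add, ← apply_const_mul]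
  refine (S k).norm_apply_le (fun x hx => ?_) (sq_nonneg t) h
  have hx1 : (1 + x) ≠ 0 := by positivity
  have h2 : heatFun t x * (resolventFun x * resolventFun x) - resolventFun x * resolventFun x +
      t * (resolventFun x - resolventFun x * resolventFun x) =
      (heatFun t x - 1 + t * x) / (1 + x) ^ 2 := by
    rw [resolventFun]; field_simp; ring
  rw [h2, abs_div, abs_of_nonneg (by positivity : (0 : ℝ) ≤ (1 + x) ^ 2),
    div_le_iff₀ (by positivity)]
  have h3 := abs_heatFun_sub_one_add_le ht hx
  have h4 : x ^ 2 ≤ (1 + x) ^ 2 := by nlinarith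
  nlinarith [mul_le_mul_of_nonneg_left h4 (sq_nonneg t)]

variable [CompleteSpace H] (hinj : ∀ g, R g = 0 → g = 0)
include hinj

theorem heatLimit_zero : P 0 = ContinuousLinearMap.id ℝ H := by
  ext g
  refine tendsto_nhds_unique (hP 0 le_rfl g) ((tendsto_apply_one hR hinj g).congr fun k => ?_)
  rw [(S k).apply_congr (φ := fun _ => 1) (ψ := heatFun 0) fun x _ => by simp [heatFun]]

theorem heatLimit_strong_cont (f : H) : Tendsto (fun s => P s f) (𝓝[>] 0) (𝓝 f) := by
  refine tendsto_of_dense_of_norm_le (C := 1) (B := ContinuousLinearMap.id ℝ H) ?_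
    (dense_range_resolvent hR hinj) ?_ f
  · filter_upwards [self_mem_nhdsWithin] with s hs g
    rw [one_mul]
    exact heatLimit_norm_le hP (le_of_lt hs) g
  · rintro _ ⟨h, rfl⟩
    rw [tendsto_iff_norm_sub_tendsto_zero]
    refine tendsto_of_tendsto_of_tendsto_of_le_of_le' tendsto_const_nhds (h := fun t => t * ‖h‖) ?_
      (Eventually.of_forall fun t => norm_nonneg _) ?_
    · have : Tendsto (fun t : ℝ => t * ‖h‖) (𝓝 0) (𝓝 (0 * ‖h‖)) := tendsto_id.mul_const _
      rw [zero_mul] at this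
      exact this.mono_left nhdsWithin_le_nhds
    · filter_upwards [self_mem_nhdsWithin] with s hs
      exact heatLimit_resolvent_sub_le hP hR (le_of_lt hs) h

/-- By the first-order estimate the difference quotients composed with `R` are contractions, so
convergence is only needed on the dense range of `R`, where the second-order estimate gives it with
a rate. -/
theorem heatLimit_tendsto_slope (h : H) :
    Tendsto (fun s : ℝ => s⁻¹ • (P s (R h) - R h)) (𝓝[>] 0) (𝓝 (R h - h)) := by
  refine tendsto_of_dense_of_norm_le (C := 1) (B := R - ContinuousLinearMap.id ℝ H)
    (T := fun s : ℝ => s⁻¹ • ((P s).comp R - R)) ?_ (dense_range_resolvent hR hinj) ?_ h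
  · filter_upwards [self_mem_nhdsWithin] with s hs g
    have hs' : 0 < s := hs
    change ‖s⁻¹ • (P s (R g) - R g)‖ ≤ 1 * ‖g‖
    rw [norm_smul, norm_inv, Real.norm_of_nonneg hs'.le, inv_mul_le_iff₀ hs', one_mul]
    exact heatLimit_resolvent_sub_le hP hR hs'.le g
  · rintro _ ⟨h, rfl⟩
    change Tendsto (fun s : ℝ => s⁻¹ • (P s (R (R h)) - R (R h))) (𝓝[>] 0) (𝓝 (R (R h) - R h))
    rw [tendsto_iff_norm_sub_tendsto_zero]
    refine tendsto_of_tendsto_of_tendsto_of_le_of_le' tendsto_const_nhds (h := fun t => t * ‖h‖) ?_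
      (Eventually.of_forall fun t => norm_nonneg _) ?_
    · have : Tendsto (fun t : ℝ => t * ‖h‖) (𝓝 0) (𝓝 (0 * ‖h‖)) := tendsto_id.mul_const _
      rw [zero_mul] at this
      exact this.mono_left nhdsWithin_le_nhds
    · filter_upwards [self_mem_nhdsWithin] with s hs
      have hs' : 0 < s := hs
      have h1 : s⁻¹ • (P s (R (R h)) - R (R h)) - (R (R h) - R h) =
          s⁻¹ • (P s (R (R h)) - R (R h) + s • (R h - R (R h))) := by
        rw [smul_add, smul_smul, inv_mul_cancel₀ hs'.ne', one_smul]
        abel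
      rw [h1, norm_smul, norm_inv, Real.norm_of_nonneg hs'.le, inv_mul_le_iff₀ hs']
      refine (heatLimit_resolvent_resolvent_sub_le hP hR hs'.le h).trans (le_of_eq ?_)
      ring

/-- The limit of the approximating semigroups is generated by `1 - R⁻¹`. -/
theorem heatLimit_isSemigroupOf {Γ : Set (H × H)} (hΓ : ∀ f g, (f, g) ∈ Γ ↔ f = R (f + g)) :
    IsSemigroupOf Γ P where
  map_zero := heatLimit_zero hP hR hinj
  map_add s t hs ht := by
    ext g
    exact heatLimit_add hP hs ht g
  strong_cont := heatLimit_strong_cont hP hR hinj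
  generator f g := by
    rw [hΓ]
    constructor
    · intro h
      have := heatLimit_tendsto_slope hP hR hinj (f + g)
      rw [← h] at this
      simpa using this
    · intro h
      -- The defect `w` has difference quotients tending to `w` itself. Contractivity gives `⟨P s w
      -- - w, w⟩ ≤ 0`, hence `‖w‖² ≤ 0`.
      have h2 := h.sub (heatLimit_tendsto_slope hP hR hinj (f + g))
      set w := f - R (f + g) with hw
      have h3 : -g - (R (f + g) - (f + g)) = w := by rw [hw]; abel
      rw [h3] at h2
      have h4 : inner ℝ w w ≤ (0 : ℝ) := by
        refine le_of_tendsto (h2.inner (tendsto_const_nhds (x := w))) ?_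
        filter_upwards [self_mem_nhdsWithin] with s hs
        have hs' : 0 < s := hs
        have h5 : s⁻¹ • (P s f - f) - s⁻¹ • (P s (R (f + g)) - R (f + g)) =
            s⁻¹ • (P s w - w) := by
          rw [← smul_sub, hw, map_sub]
          congr 1
          abel
        rw [h5, inner_smul_left, conj_trivial, inner_sub_left]
        refine mul_nonpos_of_nonneg_of_nonpos (inv_nonneg.2 hs'.le) ?_
        have h6 := real_inner_le_norm (P s w) w
        have h7 := heatLimit_norm_le hP hs'.le w
        rw [real_inner_self_eq_norm_sq]
        nlinarith [norm_nonneg w]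
      rw [← sub_eq_zero]
      exact inner_self_eq_zero.1 (le_antisymm h4 real_inner_self_nonneg)

/-- Factor `e^{-tx} = (1 + x)⁻¹ · (1 + x) e^{-tx}`; the second factor converges strongly as well. -/
theorem heatLimit_mem_range {t : ℝ} (ht : 0 < t) (g : H) : ∃ h, P t g = R h := by
  have hc := converges_heatFun_mul_pow hR hinj 1 ht g
  obtain ⟨l, hl⟩ := hc
  refine ⟨l, tendsto_nhds_unique (hP t ht.le g) ?_⟩
  refine (tendsto_apply_apply (fun x hx => abs_resolventFun_le hx) zero_le_one hl (hR _)).congr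
    fun k => ?_
  rw [← apply_mul, (S k).apply_congr fun x hx => ?_]
  rw [resolventFun, pow_one, inv_mul_cancel_left₀ (by positivity)]

/-- Symmetry gives `‖P (s/2) g‖² = ⟨g, P s g⟩`, so a zero at time `s` is inherited at `s/2`. Halving
repeatedly and strong continuity at `0` give `g = 0`. -/
theorem heatLimit_injective {t : ℝ} (ht : 0 ≤ t) {g : H} (h : P t g = 0) : g = 0 := by
  have hhalf : ∀ s : ℝ, 0 ≤ s → P s g = 0 → P (s / 2) g = 0 := by
    intro s hs h0
    have h1 := heatLimit_add hP (div_nonneg hs zero_le_two) (div_nonneg hs zero_le_two) g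
    rw [add_halves, h0] at h1
    have h2 : inner ℝ (P (s / 2) g) (P (s / 2) g) = (0 : ℝ) := by
      rw [heatLimit_symmetric hP (div_nonneg hs zero_le_two), ← h1, inner_zero_right]
    exact inner_self_eq_zero.1 h2
  rcases ht.eq_or_lt with rfl | ht'
  · rwa [heatLimit_zero hP hR hinj] at h
  have hn : ∀ n : ℕ, P (t / 2 ^ n) g = 0 := by
    intro n
    induction n with
    | zero => simpa using h
    | succ n ih =>
      have := hhalf _ (by positivity) ih
      rwa [div_div, ← pow_succ] at this
  have hlim : Tendsto (fun n : ℕ => t / 2 ^ n) atTop (𝓝[>] 0) := by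
    refine tendsto_nhdsWithin_iff.2 ⟨?_, Eventually.of_forall fun n => ?_⟩
    · have := (tendsto_pow_atTop_nhds_zero_of_lt_one (r := (1 / 2 : ℝ)) (by norm_num)
        (by norm_num)).const_mul t
      rw [mul_zero] at this
      refine this.congr fun n => ?_
      rw [div_pow, one_pow, mul_one_div]
    · exact div_pos ht' (by positivity)
  refine tendsto_nhds_unique (((heatLimit_strong_cont hP hR hinj g).comp hlim).congr fun n => ?_)
    tendsto_const_nhds
  exact hn n

end Limit

end FiniteSpectralData

/-! ### Strongly continuous semigroups: local boundedness, continuity, uniqueness -/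

namespace IsSemigroupOf

variable {H : Type*} [NormedAddCommGroup H]

section Normed

variable [NormedSpace ℝ H] {Γ : Set (H × H)} {P : ℝ → H →L[ℝ] H}

theorem apply_add (hP : IsSemigroupOf Γ P) {s t : ℝ} (hs : 0 ≤ s) (ht : 0 ≤ t) (f : H) :
    P (s + t) f = P s (P t f) := by
  rw [hP.map_add s t hs ht]
  rfl

theorem tendsto_nhdsGE (hP : IsSemigroupOf Γ P) (f : H) :
    Tendsto (fun s => P s f) (𝓝[≥] 0) (𝓝 f) := by
  have h0 : P 0 f = f := by rw [hP.map_zero]; rfl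
  have h : ContinuousWithinAt (fun s => P s f) (Set.Ioi 0) 0 := by
    rw [ContinuousWithinAt, h0]
    exact hP.strong_cont f
  have h2 := continuousWithinAt_Ioi_iff_Ici.1 h
  rwa [ContinuousWithinAt, h0] at h2

/-- `IsSemigroupOf` contains no norm bound. If there were none near `0`, times `s n → 0` with `‖P (s
n)‖ > n` would contradict the uniform boundedness principle. -/
theorem exists_norm_le_near_zero [CompleteSpace H] (hP : IsSemigroupOf Γ P) :
    ∃ δ > 0, ∃ M, ∀ s, 0 ≤ s → s ≤ δ → ‖P s‖ ≤ M := by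
  by_contra! hc
  have h : ∀ n : ℕ, ∃ s : ℝ, 0 ≤ s ∧ s ≤ 1 / ((n : ℝ) + 1) ∧ (n : ℝ) < ‖P s‖ := fun n => by
    obtain ⟨s, h1, h2, h3⟩ := hc (1 / ((n : ℝ) + 1)) (by positivity) n
    exact ⟨s, h1, h2, h3⟩
  choose s hs0 hs1 hs2 using h
  have hs : Tendsto s atTop (𝓝[≥] 0) :=
    tendsto_nhdsWithin_iff.2 ⟨squeeze_zero hs0 hs1 tendsto_one_div_add_atTop_nhds_zero_nat,
      Eventually.of_forall hs0⟩
  obtain ⟨C, hC⟩ := banach_steinhaus (g := fun n => P (s n)) fun f => by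
    obtain ⟨C, hC⟩ := ((hP.tendsto_nhdsGE f).comp hs).norm.bddAbove_range
    exact ⟨C, fun n => hC ⟨n, rfl⟩⟩
  obtain ⟨n, hn⟩ := exists_nat_gt C
  linarith [hC n, hs2 n]

theorem exists_norm_le [CompleteSpace H] (hP : IsSemigroupOf Γ P) (T : ℝ) :
    ∃ M, 0 ≤ M ∧ ∀ s, 0 ≤ s → s ≤ T → ‖P s‖ ≤ M := by
  obtain ⟨δ, hδ, M, hM⟩ := hP.exists_norm_le_near_zero
  have hM0 : 0 ≤ M := (norm_nonneg _).trans (hM 0 le_rfl hδ.le)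
  have h : ∀ n : ℕ, ∀ s : ℝ, 0 ≤ s → s ≤ ((n : ℝ) + 1) * δ → ‖P s‖ ≤ M ^ (n + 1) := by
    intro n
    induction n with
    | zero => intro s hs h; simpa using hM s hs (by simpa using h)
    | succ n ih =>
      intro s hs h
      push_cast at h
      -- Peeling off an equal share of `s`, rather than `δ`, keeps the remainder nonnegative without
      -- a case distinction.
      have hs1 : s / (n + 1 + 1) ≤ δ := by
        rw [div_le_iff₀ (by positivity)]; linarith
      have hs2 : 0 ≤ s / (n + 1 + 1) := by positivity
      have hs3 : 0 ≤ s - s / (n + 1 + 1) := by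
        have : s / (n + 1 + 1) ≤ s := div_le_self hs (by linarith [(n.cast_nonneg : (0 : ℝ) ≤ n)])
        linarith
      have hs4 : s - s / (n + 1 + 1) ≤ (n + 1) * δ := by
        have : s - s / (n + 1 + 1) = (n + 1) * (s / (n + 1 + 1)) := by field_simp; ring
        rw [this]
        exact mul_le_mul_of_nonneg_left hs1 (by positivity)
      have h5 := hP.map_add _ _ hs2 hs3
      rw [add_sub_cancel] at h5
      rw [h5, pow_succ']
      refine (ContinuousLinearMap.opNorm_comp_le _ _).trans ?_
      exact mul_le_mul (hM _ hs2 hs1) (ih _ hs3 hs4) (norm_nonneg _) hM0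
  obtain ⟨n, hn⟩ := exists_nat_gt (T / δ)
  refine ⟨M ^ (n + 1), by positivity, fun s hs hsT => h n s hs (hsT.trans ?_)⟩
  rw [div_lt_iff₀ hδ] at hn
  nlinarith

/-- Factoring out the smaller of two times bounds the increment by `M ‖P |r - s| f - f‖`. Thus
continuity from the left also reduces to continuity at `0`. -/
theorem continuousOn [CompleteSpace H] (hP : IsSemigroupOf Γ P) (f : H) :
    ContinuousOn (fun s => P s f) (Set.Ici 0) := by
  intro s hs
  obtain ⟨M, hM0, hM⟩ := hP.exists_norm_le (s + 1)
  have hs0 : (0 : ℝ) ≤ s := hs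
  have hle : ∀ a b : ℝ, 0 ≤ a → a ≤ b → a ≤ s + 1 → ‖P b f - P a f‖ ≤ M * ‖P (b - a) f - f‖ := by
    intro a b ha hab has
    have h1 := hP.apply_add ha (sub_nonneg.2 hab) f
    rw [add_sub_cancel] at h1
    rw [h1, ← map_sub]
    exact ((P a).le_opNorm _).trans (mul_le_mul_of_nonneg_right (hM a ha has) (norm_nonneg _))
  have habs : Tendsto (fun r : ℝ => |r - s|) (𝓝[Set.Ici 0] s) (𝓝[≥] 0) := by
    refine tendsto_nhdsWithin_iff.2 ⟨?_, Eventually.of_forall fun r => abs_nonneg (r - s)⟩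
    have : Tendsto (fun r : ℝ => |r - s|) (𝓝 s) (𝓝 |s - s|) :=
      (tendsto_id.sub tendsto_const_nhds).abs
    rw [sub_self, abs_zero] at this
    exact this.mono_left nhdsWithin_le_nhds
  rw [ContinuousWithinAt, tendsto_iff_norm_sub_tendsto_zero]
  refine tendsto_of_tendsto_of_tendsto_of_le_of_le' tendsto_const_nhds
    (h := fun r => M * ‖P |r - s| f - f‖) ?_ (Eventually.of_forall fun t => norm_nonneg _) ?_
  · have h1 := ((((hP.tendsto_nhdsGE f).comp habs).sub_const f).norm).const_mul M
    simpa using h1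
  · have h2 : ∀ᶠ r in 𝓝[Set.Ici 0] s, r < s + 1 :=
      nhdsWithin_le_nhds (eventually_lt_nhds (by linarith))
    filter_upwards [self_mem_nhdsWithin, h2] with r hr hr1
    rcases le_total s r with h | h
    · rw [abs_of_nonneg (sub_nonneg.2 h)]
      exact hle s r hs0 h (by linarith)
    · rw [abs_sub_comm, abs_of_nonneg (sub_nonneg.2 h), norm_sub_rev]
      exact hle r s hr h (by linarith)

theorem mem_graph_apply (hP : IsSemigroupOf Γ P) {f g : H} (h : (f, g) ∈ Γ) {s : ℝ} (hs : 0 ≤ s) :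
    (P s f, P s g) ∈ Γ := by
  rw [hP.generator]
  have h1 := ((P s).continuous.tendsto _).comp ((hP.generator f g).1 h)
  rw [map_neg] at h1
  refine h1.congr' ?_
  filter_upwards [self_mem_nhdsWithin] with r hr
  have hr' : (0 : ℝ) ≤ r := le_of_lt hr
  rw [Function.comp, map_smul, map_sub, ← hP.apply_add hs hr', ← hP.apply_add hr' hs, add_comm]

theorem hasDerivWithinAt (hP : IsSemigroupOf Γ P) {f g : H} (h : (f, g) ∈ Γ) {s : ℝ}
    (hs : 0 ≤ s) : HasDerivWithinAt (fun r => P r f) (-P s g) (Set.Ici s) s := by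
  rw [← hasDerivWithinAt_Ioi_iff_Ici, hasDerivWithinAt_iff_tendsto_slope' (by simp)]
  have hsub : Tendsto (fun r : ℝ => r - s) (𝓝[>] s) (𝓝[>] 0) := by
    refine tendsto_nhdsWithin_iff.2 ⟨?_, ?_⟩
    · have : Tendsto (fun r : ℝ => r - s) (𝓝 s) (𝓝 (s - s)) := tendsto_id.sub tendsto_const_nhds
      rw [sub_self] at this
      exact this.mono_left nhdsWithin_le_nhds
    · filter_upwards [self_mem_nhdsWithin] with r hr
      exact sub_pos.2 (show s < r from hr)
  have h1 := ((hP.generator _ _).1 (hP.mem_graph_apply h hs)).comp hsub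
  refine h1.congr' ?_
  filter_upwards [self_mem_nhdsWithin] with r hr
  rw [Function.comp, ← hP.apply_add (sub_nonneg.2 (le_of_lt hr)) hs, sub_add_cancel,
    slope_def_module]

theorem sub_mem_graph (hP : IsSemigroupOf Γ P) {f g f' g' : H} (h : (f, g) ∈ Γ)
    (h' : (f', g') ∈ Γ) : (f - f', g - g') ∈ Γ := by
  rw [hP.generator] at h h' ⊢
  have := h.sub h'
  rw [neg_sub_neg, ← neg_sub] at this
  refine this.congr fun s => ?_
  rw [← smul_sub, map_sub]
  congr 1
  abel

end Normed

/-- The strongly continuous semigroup of a densely defined accretive operator is unique. -/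
theorem unique [InnerProductSpace ℝ H] [CompleteSpace H] {Γ : Set (H × H)}
    {P P' : ℝ → H →L[ℝ] H} (hP : IsSemigroupOf Γ P) (hP' : IsSemigroupOf Γ P')
    (hacc : ∀ f g, (f, g) ∈ Γ → 0 ≤ inner ℝ f g) (hdense : Dense {f | ∃ g, (f, g) ∈ Γ})
    {t : ℝ} (ht : 0 ≤ t) : P t = P' t := by
  refine ContinuousLinearMap.ext fun f => ?_
  have key : Set.EqOn (P t) (P' t) {f | ∃ g, (f, g) ∈ Γ} := by
    rintro f ⟨g, hfg⟩
    set w : ℝ → H := fun s => P s f - P' s f with hw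
    have hd : ∀ s, 0 ≤ s → HasDerivWithinAt w (-(P s g - P' s g)) (Set.Ici s) s := by
      intro s hs
      have := (hP.hasDerivWithinAt hfg hs).sub (hP'.hasDerivWithinAt hfg hs)
      rwa [show -(P s g) - -(P' s g) = -(P s g - P' s g) by abel] at this
    have hc : ContinuousOn w (Set.Ici 0) := (hP.continuousOn f).sub (hP'.continuousOn f)
    have h0 : w 0 = 0 := by
      simp [hw, hP.map_zero, hP'.map_zero]
    -- The right derivative of `‖w‖²` is `-2⟨w, Lw⟩`, which is nonpositive by accretivity, and `w 0
    -- = 0`.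
    have h1 := image_le_of_deriv_right_le_deriv_boundary (f := fun s => ‖w s‖ ^ 2)
      (f' := fun s => 2 * inner ℝ (w s) (-(P s g - P' s g))) (a := 0) (b := t)
      ((hc.mono fun s hs => hs.1).norm.pow 2) (fun s hs => (hd s hs.1).norm_sq)
      (B := fun _ => 0) (B' := fun _ => 0) (by simp [h0]) continuousOn_const
      (fun s _ => hasDerivWithinAt_const _ _ _) (fun s hs => by
        have := hacc _ _ (hP.sub_mem_graph (hP.mem_graph_apply hfg hs.1)
          (hP'.mem_graph_apply hfg hs.1))
        rw [inner_neg_right]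
        change 2 * -inner ℝ (P s f - P' s f) (P s g - P' s g) ≤ (0 : ℝ)
        linarith) (Set.right_mem_Icc.2 ht)
    have h2 : ‖w t‖ = 0 := by
      have : ‖w t‖ ^ 2 ≤ 0 := h1
      exact pow_eq_zero_iff two_ne_zero |>.1 (le_antisymm this (sq_nonneg _))
    exact sub_eq_zero.1 (norm_eq_zero.1 h2)
  exact congrFun (Continuous.ext_on hdense (P t).continuous (P' t).continuous key) f

end IsSemigroupOf

/-! ### The space `ℓ²(X, m)`: completeness, extension by zero, delta functions -/

namespace GraphOver

variable {X : Type*} {G : GraphOver X}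

namespace Ell2

@[ext]
theorem ext {f g : G.Ell2} (h : ∀ x, f x = g x) : f = g := Subtype.ext (funext h)

@[simp] theorem zero_apply (x : X) : (0 : G.Ell2) x = 0 := rfl
@[simp] theorem neg_apply (f : G.Ell2) (x : X) : (-f) x = -f x := rfl
@[simp] theorem sub_apply (f g : G.Ell2) (x : X) : (f - g) x = f x - g x := rfl

theorem inner_eq_tsum (f g : G.Ell2) : inner ℝ f g = ∑' x, G.m x * (f x * g x) := rfl

theorem memℓp_sqrt_mul {ι : Type*} {w f : ι → ℝ} (hw : ∀ i, 0 ≤ w i) :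
    Memℓp (fun i => √(w i) * f i) 2 ↔ Summable fun i => w i * f i ^ 2 := by
  rw [memℓp_gen_iff (by norm_num)]
  refine summable_congr fun i => ?_
  simp only [ENNReal.toReal_ofNat, Real.rpow_ofNat, Real.norm_eq_abs, sq_abs, mul_pow]
  rw [Real.sq_sqrt (hw i)]

variable (G) in
/-- The isometry `f ↦ √m f` of `ℓ²(X, m)` onto `ℓ²(X)`. -/
def sqrtMul : G.Ell2 ≃ₗᵢ[ℝ] lp (fun _ : X => ℝ) 2 :=
  LinearEquiv.isometryOfInner
    { toFun := fun f => ⟨fun x => √(G.m x) * f x,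
        (memℓp_sqrt_mul fun x => (G.m_pos x).le).2 f.summable⟩
      map_add' := fun f g => by
        ext x
        change √(G.m x) * (f x + g x) = √(G.m x) * f x + √(G.m x) * g x
        ring
      map_smul' := fun a f => by
        ext x
        change √(G.m x) * (a * f x) = a * (√(G.m x) * f x)
        ring
      invFun := fun g => ⟨fun x => (√(G.m x))⁻¹ * g x, by
        refine (memℓp_sqrt_mul fun x => (G.m_pos x).le).1 ?_
        convert lp.memℓp g using 2 with x
        exact mul_inv_cancel_left₀ (Real.sqrt_pos.2 (G.m_pos x)).ne' _⟩
      left_inv := fun f => by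
        ext x
        exact inv_mul_cancel_left₀ (Real.sqrt_pos.2 (G.m_pos x)).ne' _
      right_inv := fun g => by
        ext x
        exact mul_inv_cancel_left₀ (Real.sqrt_pos.2 (G.m_pos x)).ne' _ } fun f g => by
    rw [lp.inner_eq_tsum, inner_eq_tsum]
    refine tsum_congr fun x => ?_
    change (√(G.m x) * g x) * (√(G.m x) * f x) = _
    rw [mul_mul_mul_comm, Real.mul_self_sqrt (G.m_pos x).le, mul_comm (g x)]

instance : CompleteSpace G.Ell2 :=
  (completeSpace_congr (e := (sqrtMul G).toEquiv) (sqrtMul G).isometry.isUniformEmbedding).2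
    inferInstance

theorem extendZero_apply_mem (K : Finset X) (g : K → ℝ) {x : X} (hx : x ∈ K) :
    (extendZero K g : G.Ell2) x = g ⟨x, hx⟩ := by
  simp [extendZero, hx]

theorem extendZero_apply_coe (K : Finset X) (g : K → ℝ) (x : K) :
    (extendZero K g : G.Ell2) x = g x := extendZero_apply_mem K g x.2

theorem extendZero_apply_notMem (K : Finset X) (g : K → ℝ) {x : X} (hx : x ∉ K) :
    (extendZero K g : G.Ell2) x = 0 := by
  simp [extendZero, hx]

theorem finitelySupported_extendZero (K : Finset X) (g : K → ℝ) :
    (extendZero K g : G.Ell2).FinitelySupported := by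
  refine K.finite_toSet.subset fun x hx => ?_
  by_contra h
  exact hx (extendZero_apply_notMem K g h)

theorem extendZero_restrict {K : Finset X} {f : G.Ell2} (h : ∀ x ∉ K, f x = 0) :
    extendZero K (fun x : K => f x) = f := by
  ext x
  by_cases hx : x ∈ K
  · rw [extendZero_apply_mem K _ hx]
  · rw [extendZero_apply_notMem K _ hx, h x hx]

variable (G) in
/-- Extension by zero as a linear map. -/
def extendZeroₗ (K : Finset X) : (K → ℝ) →ₗ[ℝ] G.Ell2 where
  toFun := extendZero K
  map_add' f g := by
    ext x
    rw [add_apply]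
    by_cases hx : x ∈ K
    · simp only [extendZero_apply_mem K _ hx, Pi.add_apply]
    · simp only [extendZero_apply_notMem K _ hx, add_zero]
  map_smul' a f := by
    ext x
    rw [RingHom.id_apply, smul_apply]
    by_cases hx : x ∈ K
    · simp only [extendZero_apply_mem K _ hx, Pi.smul_apply, smul_eq_mul]
    · simp only [extendZero_apply_notMem K _ hx, mul_zero]

theorem extendZeroₗ_apply (K : Finset X) (g : K → ℝ) : extendZeroₗ G K g = extendZero K g := rfl

theorem extendZero_injective (K : Finset X) :
    Function.Injective (extendZero K : (K → ℝ) → G.Ell2) := by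
  intro f g h
  funext x
  rw [← extendZero_apply_coe (G := G) K f x, h, extendZero_apply_coe]

theorem inner_extendZero_right (K : Finset X) (f : G.Ell2) (g : K → ℝ) :
    inner ℝ f (extendZero K g) = ∑ x : K, G.m x * (f x * g x) := by
  rw [inner_eq_tsum, tsum_eq_sum (s := K), ← Finset.sum_coe_sort]
  · exact Finset.sum_congr rfl fun x _ => by rw [extendZero_apply_coe]
  · intro x hx
    rw [extendZero_apply_notMem K g hx, mul_zero, mul_zero]

theorem inner_extendZero_extendZero (K : Finset X) (f g : K → ℝ) :
    inner ℝ (extendZero K f : G.Ell2) (extendZero K g) = ∑ x : K, G.m x * (f x * g x) := by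
  rw [inner_extendZero_right]
  exact Finset.sum_congr rfl fun x _ => by rw [extendZero_apply_coe]

variable (G) in
/-- The function that is `1` at `x` and `0` elsewhere. -/
def delta (x : X) : G.Ell2 := extendZero {x} fun _ => 1

@[simp] theorem delta_self (x : X) : delta G x x = 1 :=
  extendZero_apply_mem _ _ (Finset.mem_singleton_self x)

theorem delta_of_ne {x y : X} (h : y ≠ x) : delta G x y = 0 :=
  extendZero_apply_notMem _ _ (by simpa using h)

theorem delta_nonneg (x y : X) : 0 ≤ delta G x y := by
  by_cases h : y = x
  · subst h; simp
  · rw [delta_of_ne h]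

theorem delta_ne_zero (x : X) : delta G x ≠ 0 := fun h => by
  have := delta_self (G := G) x
  rw [h] at this
  simp at this

theorem inner_delta_right (f : G.Ell2) (x : X) : inner ℝ f (delta G x) = G.m x * f x := by
  rw [delta, inner_extendZero_right]
  simp

theorem apply_eq_inner (f : G.Ell2) (x : X) : f x = (G.m x)⁻¹ * inner ℝ f (delta G x) := by
  rw [inner_delta_right, inv_mul_cancel_left₀ (G.m_pos x).ne']

theorem tendsto_apply {α : Type*} {l : Filter α} {u : α → G.Ell2} {f : G.Ell2}
    (h : Tendsto u l (𝓝 f)) (x : X) : Tendsto (fun a => u a x) l (𝓝 (f x)) := by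
  simp only [apply_eq_inner _ x]
  exact (h.inner tendsto_const_nhds).const_mul _

theorem tendsto_extendZero_restrict {K : ℕ → Finset X} (hK : Tendsto K atTop atTop) (f : G.Ell2) :
    Tendsto (fun k => (extendZero (K k) fun x => f x : G.Ell2)) atTop (𝓝 f) := by
  have h1 : ∀ k, ‖(extendZero (K k) fun x => f x : G.Ell2) - f‖ ^ 2 =
      inner ℝ f f - ∑ x ∈ K k, G.m x * (f x * f x) := by
    intro k
    rw [← real_inner_self_eq_norm_sq, inner_sub_left, inner_sub_right, inner_sub_right,
      inner_extendZero_extendZero, real_inner_comm, inner_extendZero_right,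
      Finset.sum_coe_sort (K k) fun x => G.m x * (f x * f x)]
    ring
  have h2 : Tendsto (fun k => inner ℝ f f - ∑ x ∈ K k, G.m x * (f x * f x)) atTop (𝓝 0) := by
    have h3 := ((f.summable_mul f).hasSum.comp hK).const_sub (inner ℝ f f)
    rw [← inner_eq_tsum, sub_self] at h3
    exact h3
  rw [tendsto_iff_norm_sub_tendsto_zero]
  simp only [← h1] at h2
  have h4 := h2.sqrt
  simpa using h4

end Ell2

theorem IsExhaustion.monotone {K : ℕ → Finset X} (hK : G.IsExhaustion K) : Monotone K :=
  monotone_nat_of_le_succ hK.mono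

theorem IsExhaustion.tendsto_atTop {K : ℕ → Finset X} (hK : G.IsExhaustion K) :
    Tendsto K atTop atTop :=
  tendsto_atTop_finset_of_monotone hK.monotone hK.exhaust

end GraphOver

/-! ### Exponentials of operators and their comparison -/

section Exponential

theorem hasSum_exp_apply {E : Type*} [NormedAddCommGroup E] [NormedSpace ℝ E] [CompleteSpace E]
    (T : E →L[ℝ] E) (v : E) :
    HasSum (fun n : ℕ => ((n.factorial : ℝ)⁻¹) • (T ^ n) v) (NormedSpace.exp T v) :=
  (NormedSpace.exp_series_hasSum_exp' (𝕂 := ℝ) T).mapL (ContinuousLinearMap.apply ℝ E v)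

theorem exp_apply_of_eigenvector {E : Type*} [NormedAddCommGroup E] [NormedSpace ℝ E]
    [CompleteSpace E] {T : E →L[ℝ] E} {v : E} {a : ℝ} (h : T v = a • v) :
    NormedSpace.exp T v = Real.exp a • v := by
  have hpow : ∀ n : ℕ, (T ^ n) v = a ^ n • v := by
    intro n
    induction n with
    | zero => simp
    | succ n ih => rw [pow_succ', mul_apply_eq_comp, ih, map_smul, h, smul_smul, pow_succ]
  refine (hasSum_exp_apply T v).unique ?_
  have h1 := (NormedSpace.exp_series_hasSum_exp' (𝕂 := ℝ) a).smul_const v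
  rw [← Real.exp_eq_exp_ℝ] at h1
  simpa only [hpow, smul_smul, smul_eq_mul] using h1

variable {ι : Type*} [Fintype ι]

/-- A shift by a scalar commutes with `L`. For large `M` it makes `M - L` positivity preserving, so
that signs can be read off from the power series. -/
theorem exp_neg_smul_eq (L : (ι → ℝ) →L[ℝ] (ι → ℝ)) (t M : ℝ) (f : ι → ℝ) :
    NormedSpace.exp (-t • L) f =
      Real.exp (-t * M) • NormedSpace.exp (t • (M • ContinuousLinearMap.id ℝ (ι → ℝ) - L)) f := by
  let : NormedAlgebra ℚ ((ι → ℝ) →L[ℝ] (ι → ℝ)) := NormedAlgebra.restrictScalars ℚ ℝ _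
  have h1 : -t • L = (-t * M) • (1 : (ι → ℝ) →L[ℝ] (ι → ℝ)) +
      t • (M • ContinuousLinearMap.id ℝ (ι → ℝ) - L) := by
    ext1 v
    simp [smul_smul, smul_sub]
    abel
  rw [h1, NormedSpace.exp_add_of_commute ((Commute.one_left _).smul_left _),
    mul_apply_eq_comp]
  exact exp_apply_of_eigenvector (by simp)

/-- Comparison of the semigroups of two operators with nonpositive off-diagonal part. -/
theorem exp_nonneg_and_le {L L' : (ι → ℝ) →L[ℝ] (ι → ℝ)} {M t : ℝ} (ht : 0 ≤ t)
    (hM : ∀ f, 0 ≤ f → L' f ≤ M • f) (hL : ∀ f, 0 ≤ f → L f ≤ L' f) {f : ι → ℝ} (hf : 0 ≤ f) :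
    0 ≤ NormedSpace.exp (-t • L') f ∧
      NormedSpace.exp (-t • L') f ≤ NormedSpace.exp (-t • L) f := by
  have hpow : ∀ n : ℕ,
      0 ≤ ((t • (M • ContinuousLinearMap.id ℝ (ι → ℝ) - L')) ^ n) f ∧
      ((t • (M • ContinuousLinearMap.id ℝ (ι → ℝ) - L')) ^ n) f ≤
        ((t • (M • ContinuousLinearMap.id ℝ (ι → ℝ) - L)) ^ n) f := by
    intro n
    induction n with
    | zero => simpa using hf
    | succ n ih =>
      rw [pow_succ', pow_succ', mul_apply_eq_comp, mul_apply_eq_comp]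
      set u := ((t • (M • ContinuousLinearMap.id ℝ (ι → ℝ) - L')) ^ n) f
      set v := ((t • (M • ContinuousLinearMap.id ℝ (ι → ℝ) - L)) ^ n) f
      change 0 ≤ t • (M • u - L' u) ∧ t • (M • u - L' u) ≤ t • (M • v - L v)
      refine ⟨smul_nonneg ht (sub_nonneg.2 (hM u ih.1)), smul_le_smul_of_nonneg_left ?_ ht⟩
      have h1 := hM (v - u) (sub_nonneg.2 ih.2)
      have h2 := hL (v - u) (sub_nonneg.2 ih.2)
      have h3 := hL u ih.1
      rw [map_sub L, map_sub L'] at h2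
      rw [map_sub, smul_sub] at h1
      intro x
      have h1 := h1 x
      have h2 := h2 x
      have h3 := h3 x
      simp only [Pi.sub_apply] at *
      linarith
  rw [exp_neg_smul_eq L t M, exp_neg_smul_eq L' t M]
  refine ⟨smul_nonneg (Real.exp_pos _).le ((hasSum_exp_apply _ f).nonneg fun n => ?_),
    smul_le_smul_of_nonneg_left (hasSum_le (fun n => ?_) (hasSum_exp_apply _ f)
      (hasSum_exp_apply _ f)) (Real.exp_pos _).le⟩
  · exact smul_nonneg (by positivity) (hpow n).1
  · exact smul_le_smul_of_nonneg_left (hpow n).2 (by positivity)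

end Exponential

/-! ### Diagonalization of operators on finite vertex sets -/

/-- A symmetric nonnegative operator on a finite-dimensional space is diagonalizable. -/
theorem FiniteSpectralData.exists_eigenvectors {H E : Type*} [NormedAddCommGroup H]
    [InnerProductSpace ℝ H] [AddCommGroup E] [Module ℝ E] [FiniteDimensional ℝ E]
    (j : E →ₗ[ℝ] H) (hj : Function.Injective j) (L : E →ₗ[ℝ] E)
    (hsym : ∀ f g, inner ℝ (j (L f)) (j g) = inner ℝ (j f) (j (L g)))
    (hpos : ∀ f, 0 ≤ inner ℝ (j (L f)) (j f)) :
    ∃ S : FiniteSpectralData H, ∃ w : Fin S.n → E, (∀ i, S.vec i = j (w i)) ∧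
      (∀ i, L (w i) = S.eig i • w i) ∧ ∀ f, f = ∑ i, inner ℝ (S.vec i) (j f) • w i := by
  let e := LinearEquiv.ofInjective j hj
  have he : ∀ f, ((e f : LinearMap.range j) : H) = j f := fun f => rfl
  let A : LinearMap.range j →ₗ[ℝ] LinearMap.range j := e.toLinearMap ∘ₗ L ∘ₗ e.symm.toLinearMap
  have hA : ∀ f, A (e f) = e (L f) := fun f => by simp [A]
  have hinner : ∀ f g, inner ℝ (e f) (e g) = inner ℝ (j f) (j g) := fun f g => rfl
  have hAs : A.IsSymmetric := by
    intro u v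
    obtain ⟨f, rfl⟩ := e.surjective u
    obtain ⟨g, rfl⟩ := e.surjective v
    rw [hA, hA, hinner, hinner, hsym]
  let B := hAs.eigenvectorBasis rfl
  have hB : ∀ i, L (e.symm (B i)) = hAs.eigenvalues rfl i • e.symm (B i) := by
    intro i
    apply e.injective
    rw [← hA, map_smul, e.apply_symm_apply]
    exact hAs.apply_eigenvectorBasis rfl i
  have hjB : ∀ i, j (e.symm (B i)) = (B i : H) := fun i => by rw [← he, e.apply_symm_apply]
  refine ⟨⟨_, fun i => (B i : H), hAs.eigenvalues rfl, ?_, ?_⟩, fun i => e.symm (B i),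
    fun i => (hjB i).symm, hB, ?_⟩
  · exact B.orthonormal.comp_linearIsometry (LinearMap.range j).subtypeₗᵢ
  · intro i
    have h1 := hpos (e.symm (B i))
    rw [hB, map_smul, hjB, real_inner_smul_left, real_inner_self_eq_norm_sq, ← Submodule.coe_norm,
      B.norm_eq_one, one_pow, mul_one] at h1
    exact h1
  · intro f
    apply e.injective
    rw [map_sum]
    simp only [map_smul, e.apply_symm_apply]
    exact (B.sum_repr' (e f)).symm

namespace GraphOver

variable {X : Type*} {G : GraphOver X}

open Ell2 FiniteSpectralData

/-- `S` diagonalizes the operator `L` on functions on `K`, regarded as part of `ℓ²(X, m)`. -/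
def Diagonalizes (K : Finset X) (L : (K → ℝ) →ₗ[ℝ] (K → ℝ)) (S : FiniteSpectralData G.Ell2) :
    Prop :=
  ∃ w : Fin S.n → K → ℝ, (∀ i, S.vec i = extendZero K (w i)) ∧
    (∀ i, L (w i) = S.eig i • w i) ∧
    ∀ g : G.Ell2, (fun x : K => g x) = ∑ i, inner ℝ (S.vec i) g • w i

theorem exists_diagonalizes (K : Finset X) (L : (K → ℝ) →ₗ[ℝ] (K → ℝ))
    (hsym : ∀ f g : K → ℝ, ∑ x : K, G.m x * (L f x * g x) = ∑ x : K, G.m x * (f x * L g x))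
    (hpos : ∀ f : K → ℝ, 0 ≤ ∑ x : K, G.m x * (L f x * f x)) :
    ∃ S : FiniteSpectralData G.Ell2, Diagonalizes K L S := by
  obtain ⟨S, w, hw1, hw2, hw3⟩ := exists_eigenvectors (extendZeroₗ G K) (extendZero_injective K) L
    (fun f g => by
      simp only [extendZeroₗ_apply, inner_extendZero_extendZero]
      exact hsym f g)
    (fun f => by
      simp only [extendZeroₗ_apply, inner_extendZero_extendZero]
      exact hpos f)
  refine ⟨S, w, hw1, hw2, fun g => (hw3 _).trans (Finset.sum_congr rfl fun i _ => ?_)⟩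
  -- The eigenvectors vanish off `K`, so the coefficients see only the restriction of `g` to `K`.
  rw [hw1 i, extendZeroₗ_apply, extendZeroₗ_apply, real_inner_comm, real_inner_comm g,
    inner_extendZero_extendZero, inner_extendZero_right]

variable {K : Finset X} {L : (K → ℝ) →ₗ[ℝ] (K → ℝ)} {S : FiniteSpectralData G.Ell2}

/-- The restriction of `g` to `K` is a combination of eigenvectors, so it is enough to know `T` on
those. -/
theorem Diagonalizes.apply_eq (h : Diagonalizes K L S) (T : (K → ℝ) →ₗ[ℝ] (K → ℝ)) {φ : ℝ → ℝ}
    (hT : ∀ i (w : K → ℝ), L w = S.eig i • w → T w = φ (S.eig i) • w) (g : G.Ell2) :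
    S.apply φ g = extendZero K (T fun x : K => g x) := by
  obtain ⟨w, hw1, hw2, hw3⟩ := h
  rw [apply_apply, hw3 g, ← extendZeroₗ_apply, map_sum, map_sum]
  refine Finset.sum_congr rfl fun i _ => ?_
  rw [map_smul, map_smul, hT i _ (hw2 i), map_smul, extendZeroₗ_apply, ← hw1 i, smul_smul, mul_comm]

theorem Diagonalizes.heat (h : Diagonalizes K L S) (t : ℝ) (g : G.Ell2) :
    S.apply (heatFun t) g = extendZero K
      (NormedSpace.exp (-t • LinearMap.toContinuousLinearMap L) (fun x : K => g x)) := by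
  refine h.apply_eq (NormedSpace.exp (-t • LinearMap.toContinuousLinearMap L)).toLinearMap
    (fun i w hw => ?_) g
  have h1 : (-t • LinearMap.toContinuousLinearMap L) w = (-(t * S.eig i)) • w := by
    change -t • L w = _
    rw [hw, smul_smul, neg_mul]
  exact exp_apply_of_eigenvector h1

theorem Diagonalizes.resolvent (h : Diagonalizes K L S) (g : G.Ell2) :
    ∃ ρ : K → ℝ, S.apply resolventFun g = extendZero K ρ ∧ L ρ + ρ = fun x : K => g x := by
  obtain ⟨w, hw1, hw2, hw3⟩ := h
  refine ⟨∑ i, (resolventFun (S.eig i) * inner ℝ (S.vec i) g) • w i, ?_, ?_⟩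
  · rw [apply_apply, ← extendZeroₗ_apply, map_sum]
    exact Finset.sum_congr rfl fun i _ => by rw [map_smul, extendZeroₗ_apply, ← hw1 i]
  · rw [hw3 g, map_sum, ← Finset.sum_add_distrib]
    refine Finset.sum_congr rfl fun i _ => ?_
    rw [map_smul, hw2, smul_smul, ← add_smul, resolventFun]
    have := S.eig_nonneg i
    congr 1
    field_simp
    ring

end GraphOver

/-! ### Forms as subspaces of a Hilbert space, and their resolvents -/

namespace PartialForm

variable {H W : Type*} [NormedAddCommGroup H] [InnerProductSpace ℝ H] [CompleteSpace H]
  [NormedAddCommGroup W] [InnerProductSpace ℝ W] [CompleteSpace W]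

/-- The form `Q` on `H`, with its form norm, is identified through `j` with the subspace `F`. -/
structure Represents (Q : PartialForm H) (j : W →L[ℝ] H) (F : Submodule ℝ W) : Prop where
  exists_inner_eq : ∀ w ∈ F, ∃ hw : j w ∈ Q.domain, ∀ w' ∈ F, ∀ hw' : j w' ∈ Q.domain,
    inner ℝ w w' = Q.toFun ⟨j w, hw⟩ ⟨j w', hw'⟩ + inner ℝ (j w) (j w')
  surj : ∀ f ∈ Q.domain, ∃ w ∈ F, j w = f

/-- The resolvent at `-1` of the form represented by `F`. -/
def formResolvent (j : W →L[ℝ] H) (F : Submodule ℝ W) [F.HasOrthogonalProjection] : H →L[ℝ] H :=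
  j ∘L F.starProjection ∘L ContinuousLinearMap.adjoint j

variable {Q : PartialForm H} {j : W →L[ℝ] H} {F : Submodule ℝ W} [F.HasOrthogonalProjection]

/-- The weak form of the resolvent equation: in terms of the form this says `Q(u, v) + ⟨u, v⟩ = ⟨h,
v⟩` on the domain. -/
theorem inner_starProjection_adjoint (h : H) {w : W} (hw : w ∈ F) :
    inner ℝ (F.starProjection (ContinuousLinearMap.adjoint j h)) w = inner ℝ h (j w) := by
  rw [Submodule.inner_starProjection_left_eq_right, Submodule.starProjection_eq_self_iff.2 hw,
    ContinuousLinearMap.adjoint_inner_left]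

theorem eq_starProjection_adjoint {h : H} {u : W} (hu : u ∈ F)
    (hw : ∀ w ∈ F, inner ℝ u w = inner ℝ h (j w)) :
    F.starProjection (ContinuousLinearMap.adjoint j h) = u := by
  refine F.eq_starProjection_of_mem_of_inner_eq_zero hu fun w hwF => ?_
  rw [inner_sub_left, ContinuousLinearMap.adjoint_inner_left, hw w hwF, sub_self]

/-- Adding `⟨f, ·⟩` to `Q(f, ·) = ⟨g, ·⟩` turns the left side into the inner product of `F`, and the
equation into a Riesz representation with datum `f + g`. -/
theorem Represents.mem_operatorGraph_iff (hQ : Q.Represents j F) (f g : H) :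
    (f, g) ∈ Q.operatorGraph ↔ f = formResolvent j F (f + g) := by
  constructor
  · rintro ⟨hf, hfg⟩
    obtain ⟨w, hwF, rfl⟩ := hQ.surj f hf
    have h := eq_starProjection_adjoint (j := j) (h := j w + g) hwF fun w' hw' => by
      obtain ⟨h1, h2⟩ := hQ.exists_inner_eq w hwF
      obtain ⟨h3, -⟩ := hQ.exists_inner_eq w' hw'
      rw [h2 w' hw' h3, inner_add_left, add_comm]
      congr 1
      exact hfg ⟨j w', h3⟩
    change j w = j (F.starProjection (ContinuousLinearMap.adjoint j (j w + g)))
    rw [h]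
  · intro h
    set w := F.starProjection (ContinuousLinearMap.adjoint j (f + g)) with hw
    have hwF : w ∈ F := F.starProjection_apply_mem _
    have hf : f = j w := h
    obtain ⟨h1, h2⟩ := hQ.exists_inner_eq w hwF
    refine ⟨show f ∈ Q.domain by rw [hf]; exact h1, ?_⟩
    rintro ⟨v, hv⟩
    obtain ⟨w', hw', rfl⟩ := hQ.surj v hv
    have h3 := h2 w' hw' hv
    have h5 : inner ℝ w w' = inner ℝ (f + g) (j w') := inner_starProjection_adjoint _ hw'
    rw [inner_add_left] at h5
    have h6 : inner ℝ f (j w') = inner ℝ (j w) (j w') := by rw [← hf]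
    have h4 : Q.toFun ⟨f, by rw [hf]; exact h1⟩ ⟨j w', hv⟩ = Q.toFun ⟨j w, h1⟩ ⟨j w', hv⟩ := by
      congr 1
      exact Subtype.ext hf
    change Q.toFun ⟨f, _⟩ ⟨j w', hv⟩ = inner ℝ g (j w')
    rw [h4]
    linarith

/-- If `w ∈ F` lies over `f`, then `⟨f, g⟩ = ‖w‖² - ‖j w‖²`. -/
theorem Represents.inner_nonneg (hQ : Q.Represents j F) (hj : ∀ w, ‖j w‖ ≤ ‖w‖) (f g : H)
    (h : (f, g) ∈ Q.operatorGraph) : 0 ≤ inner ℝ f g := by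
  rw [hQ.mem_operatorGraph_iff] at h
  set w := F.starProjection (ContinuousLinearMap.adjoint j (f + g)) with hw
  have hwF : w ∈ F := F.starProjection_apply_mem _
  have hf : f = j w := h
  have h1 : inner ℝ w w = inner ℝ (f + g) (j w) := inner_starProjection_adjoint _ hwF
  rw [inner_add_left, ← hf, real_inner_self_eq_norm_sq, real_inner_self_eq_norm_sq] at h1
  have h2 := hj w
  rw [← hf] at h2
  rw [real_inner_comm]
  nlinarith [norm_nonneg f]

/-- For `w = P_F j* h` one has `‖w‖² = ⟨h, j w⟩`. So `j w = 0` forces `w = 0`, that is, `h` is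
orthogonal to `j F`. -/
theorem formResolvent_injective (hF : ∀ h : H, (∀ w ∈ F, inner ℝ h (j w) = 0) → h = 0) (h : H)
    (h0 : formResolvent j F h = 0) : h = 0 := by
  set w := F.starProjection (ContinuousLinearMap.adjoint j h) with hw
  have hwF : w ∈ F := F.starProjection_apply_mem _
  have h1 : inner ℝ w w = inner ℝ h (j w) := inner_starProjection_adjoint _ hwF
  have h2 : j w = 0 := h0
  rw [h2, inner_zero_right, inner_self_eq_zero] at h1
  refine hF h fun w' hw' => ?_
  rw [← inner_starProjection_adjoint h hw', ← hw, h1, inner_zero_left]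

/-- Injectivity of `j` on `F'` lifts equality of resolvents to equality of the projections of `j*
g`. A vector `v ∈ F'` orthogonal to `F` then satisfies `⟨g, j v⟩ = ⟨P_{F'} j* g, v⟩ = 0` for all
`g`, so it vanishes. -/
theorem eq_of_formResolvent_eq {F' : Submodule ℝ W} [F'.HasOrthogonalProjection] (hle : F ≤ F')
    (hinj : ∀ w ∈ F', j w = 0 → w = 0) (h : formResolvent j F = formResolvent j F') : F = F' := by
  refine le_antisymm hle fun w hw => ?_
  have hproj : ∀ g, F'.starProjection (ContinuousLinearMap.adjoint j g) ∈ F := by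
    intro g
    have h1 : j (F.starProjection (ContinuousLinearMap.adjoint j g)) =
        j (F'.starProjection (ContinuousLinearMap.adjoint j g)) := DFunLike.congr_fun h g
    have h2 := hinj _ (F'.sub_mem (hle (F.starProjection_apply_mem
      (ContinuousLinearMap.adjoint j g))) (F'.starProjection_apply_mem
      (ContinuousLinearMap.adjoint j g))) (by rw [map_sub, h1, sub_self])
    rw [← sub_eq_zero.1 h2]
    exact F.starProjection_apply_mem _
  set v := w - F.starProjection w with hv
  have hvF' : v ∈ F' := F'.sub_mem hw (hle (F.starProjection_apply_mem _))
  have hjv : j v = 0 := by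
    refine ext_inner_left ℝ fun g => ?_
    rw [inner_zero_right, ← inner_starProjection_adjoint g hvF', real_inner_comm]
    exact F.starProjection_inner_eq_zero w _ (hproj g)
  have hv0 := hinj v hvF' hjv
  rw [sub_eq_zero.1 hv0]
  exact F.starProjection_apply_mem _

open FiniteSpectralData

/-- If the resolvents of finite-dimensional approximations converge to the resolvent of `Q`, then
their semigroups converge to the semigroup of `Q`, which exists. -/
theorem Represents.isSemigroupOf_and_tendsto (hQ : Q.Represents j F) (hj : ∀ w, ‖j w‖ ≤ ‖w‖)
    (hF : ∀ h : H, (∀ w ∈ F, inner ℝ h (j w) = 0) → h = 0) {S : ℕ → FiniteSpectralData H}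
    (hR : ∀ g, Tendsto (fun k => (S k).apply resolventFun g) atTop (𝓝 (formResolvent j F g))) :
    IsSemigroupOf Q.operatorGraph Q.semigroup ∧ ∀ t, 0 ≤ t → ∀ g,
      Tendsto (fun k => (S k).apply (heatFun t) g) atTop (𝓝 (Q.semigroup t g)) := by
  have hinj := formResolvent_injective hF
  obtain ⟨P, hP⟩ := exists_heatLimit hR hinj
  have hPs := heatLimit_isSemigroupOf hP hR hinj hQ.mem_operatorGraph_iff
  -- The limit `P` is the existence witness that makes the choice in `Q.semigroup` meaningful;
  -- uniqueness below then identifies the two.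
  have hQs : IsSemigroupOf Q.operatorGraph Q.semigroup := Classical.epsilon_spec ⟨P, hPs⟩
  refine ⟨hQs, fun t ht g => ?_⟩
  have hdense : Dense {f | ∃ g, (f, g) ∈ Q.operatorGraph} := by
    refine (dense_range_resolvent hR hinj).mono ?_
    rintro _ ⟨h, rfl⟩
    refine ⟨h - formResolvent j F h, (hQ.mem_operatorGraph_iff _ _).2 ?_⟩
    rw [add_sub_cancel]
  rw [hQs.unique hPs (hQ.inner_nonneg hj) hdense ht]
  exact hP t ht g

end PartialForm

/-! ### The Dirichlet and Neumann forms inside the gradient space -/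

namespace GraphOver

variable {X : Type*} (G : GraphOver X)

open Ell2

/-- The Hilbert space containing the graph of the discrete gradient, `f ↦ (f, ∇f, √c f)`. -/
abbrev GradientSpace : Type _ :=
  WithLp 2 (G.Ell2 × WithLp 2 (lp (fun _ : X × X => ℝ) 2 × lp (fun _ : X => ℝ) 2))

/-- The projection of `GradientSpace` to `ℓ²(X, m)`. -/
def gradientFst : G.GradientSpace →L[ℝ] G.Ell2 :=
  WithLp.fstL 2 ℝ G.Ell2 (WithLp 2 (lp (fun _ : X × X => ℝ) 2 × lp (fun _ : X => ℝ) 2))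

variable {G}

theorem norm_gradientFst_le (w : G.GradientSpace) : ‖G.gradientFst w‖ ≤ ‖w‖ :=
  WithLp.norm_fst_le _ w

theorem continuous_gradientFst_apply (x : X) :
    Continuous fun w : G.GradientSpace => G.gradientFst w x :=
  continuous_iff_continuousAt.2 fun w => tendsto_apply (G.gradientFst.continuous.tendsto w) x

variable (G)

/-- The graph of the discrete gradient. -/
def neumannSpace : Submodule ℝ G.GradientSpace where
  -- Dividing `b` by `2` under the root absorbs the factor `1/2` of the energy.
  carrier := {w | (∀ p : X × X, w.snd.fst p =
      √(G.b p.1 p.2 / 2) * (G.gradientFst w p.1 - G.gradientFst w p.2)) ∧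
    ∀ x, w.snd.snd x = √(G.c x) * G.gradientFst w x}
  add_mem' {w v} hw hv := by
    refine ⟨fun p => ?_, fun x => ?_⟩
    · change w.snd.fst p + v.snd.fst p = √(G.b p.1 p.2 / 2) *
        ((G.gradientFst w p.1 + G.gradientFst v p.1) - (G.gradientFst w p.2 + G.gradientFst v p.2))
      rw [hw.1, hv.1]
      ring
    · change w.snd.snd x + v.snd.snd x = √(G.c x) * (G.gradientFst w x + G.gradientFst v x)
      rw [hw.2, hv.2]
      ring
  zero_mem' := by
    refine ⟨fun p => ?_, fun x => ?_⟩
    · change (0 : ℝ) = √(G.b p.1 p.2 / 2) * (0 - 0)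
      ring
    · change (0 : ℝ) = √(G.c x) * 0
      ring
  smul_mem' a w hw := by
    refine ⟨fun p => ?_, fun x => ?_⟩
    · change a * w.snd.fst p = √(G.b p.1 p.2 / 2) *
        (a * G.gradientFst w p.1 - a * G.gradientFst w p.2)
      rw [hw.1]
      ring
    · change a * w.snd.snd x = √(G.c x) * (a * G.gradientFst w x)
      rw [hw.2]
      ring

/-- The defining equations are pointwise and evaluations are continuous. This is the closedness of
the Neumann form. -/
theorem isClosed_neumannSpace : IsClosed (G.neumannSpace : Set G.GradientSpace) := by
  have h1 : Continuous fun w : G.GradientSpace => w.snd.fst :=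
    (WithLp.fstL 2 ℝ _ _).continuous.comp (WithLp.sndL 2 ℝ _ _).continuous
  have h2 : Continuous fun w : G.GradientSpace => w.snd.snd :=
    (WithLp.sndL 2 ℝ _ _).continuous.comp (WithLp.sndL 2 ℝ _ _).continuous
  have h : (G.neumannSpace : Set G.GradientSpace) =
      (⋂ p : X × X, {w : G.GradientSpace | w.snd.fst p =
        √(G.b p.1 p.2 / 2) * (G.gradientFst w p.1 - G.gradientFst w p.2)}) ∩
      ⋂ x, {w : G.GradientSpace | w.snd.snd x = √(G.c x) * G.gradientFst w x} := by
    ext w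
    simp only [Set.mem_inter_iff, Set.mem_iInter]
    rfl
  rw [h]
  refine (isClosed_iInter fun p => isClosed_eq ?_ ?_).inter (isClosed_iInter fun x =>
    isClosed_eq ?_ ?_)
  · exact (lp.lipschitzWith_one_eval 2 p).continuous.comp h1
  · exact continuous_const.mul
      ((continuous_gradientFst_apply p.1).sub (continuous_gradientFst_apply p.2))
  · exact (lp.lipschitzWith_one_eval 2 x).continuous.comp h2
  · exact continuous_const.mul (continuous_gradientFst_apply x)

variable {G}

theorem gradientFst_mem_neumannDomain {w : G.GradientSpace} (hw : w ∈ G.neumannSpace) :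
    G.gradientFst w ∈ G.neumannDomain := by
  constructor
  · have h : Memℓp (fun p : X × X => √(G.b p.1 p.2 / 2) *
        (G.gradientFst w p.1 - G.gradientFst w p.2)) 2 := by
      convert lp.memℓp w.snd.fst using 2 with p
      exact (hw.1 p).symm
    have h' := (memℓp_sqrt_mul (w := fun p : X × X => G.b p.1 p.2 / 2)
      (f := fun p => G.gradientFst w p.1 - G.gradientFst w p.2)
      fun p => div_nonneg (G.b_nonneg p.1 p.2) zero_le_two).1 h
    exact (h'.mul_left 2).congr fun p => by ring
  · have h : Memℓp (fun x : X => √(G.c x) * G.gradientFst w x) 2 := by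
      convert lp.memℓp w.snd.snd using 2 with p
      exact (hw.2 p).symm
    rwa [memℓp_sqrt_mul G.c_nonneg] at h

theorem inner_eq_energy {w v : G.GradientSpace} (hw : w ∈ G.neumannSpace)
    (hv : v ∈ G.neumannSpace) :
    inner ℝ w v = G.energy (G.gradientFst w) (G.gradientFst v) +
      inner ℝ (G.gradientFst w) (G.gradientFst v) := by
  rw [WithLp.prod_inner_apply, WithLp.prod_inner_apply, add_comm]
  congr 1
  rw [lp.inner_eq_tsum, lp.inner_eq_tsum, energy, ← tsum_mul_left]
  congr 1
  · refine tsum_congr fun p => ?_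
    change v.snd.fst p * w.snd.fst p = _
    rw [hw.1 p, hv.1 p, mul_mul_mul_comm,
      Real.mul_self_sqrt (div_nonneg (G.b_nonneg p.1 p.2) zero_le_two)]
    ring
  · refine tsum_congr fun x => ?_
    change v.snd.snd x * w.snd.snd x = _
    rw [hw.2 x, hv.2 x, mul_mul_mul_comm, Real.mul_self_sqrt (G.c_nonneg x)]
    ring

theorem norm_sq_eq_formNormSq {w : G.GradientSpace} (hw : w ∈ G.neumannSpace) :
    ‖w‖ ^ 2 = G.formNormSq (G.gradientFst w) := by
  rw [← real_inner_self_eq_norm_sq, inner_eq_energy hw hw, real_inner_self_eq_norm_sq]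
  rfl

theorem exists_lift {f : G.Ell2} (hf : f ∈ G.neumannDomain) :
    ∃ w ∈ G.neumannSpace, G.gradientFst w = f := by
  have h1 : Memℓp (fun p : X × X => √(G.b p.1 p.2 / 2) * (f p.1 - f p.2)) 2 := by
    refine (memℓp_sqrt_mul (w := fun p : X × X => G.b p.1 p.2 / 2) (f := fun p => f p.1 - f p.2)
      fun p => div_nonneg (G.b_nonneg p.1 p.2) zero_le_two).2 ?_
    exact (hf.1.mul_left (1 / 2)).congr fun p => by ring
  have h2 : Memℓp (fun x : X => √(G.c x) * f x) 2 := by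
    rw [memℓp_sqrt_mul G.c_nonneg]
    exact hf.2
  exact ⟨WithLp.toLp 2 (f, WithLp.toLp 2 (⟨_, h1⟩, ⟨_, h2⟩)), ⟨fun p => rfl, fun x => rfl⟩, rfl⟩

theorem eq_zero_of_gradientFst_eq_zero {w : G.GradientSpace} (hw : w ∈ G.neumannSpace)
    (h : G.gradientFst w = 0) : w = 0 := by
  have h1 := inner_eq_energy hw hw
  rw [h, inner_zero_left, add_zero] at h1
  rw [← inner_self_eq_zero (𝕜 := ℝ), h1]
  simp [energy]

variable (G)

theorem represents_neumannForm : G.neumannForm.Represents G.gradientFst G.neumannSpace where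
  exists_inner_eq _ hw := ⟨gradientFst_mem_neumannDomain hw, fun _ hw' _ => inner_eq_energy hw hw'⟩
  surj _ hf := exists_lift hf

/-- The functions in `neumannSpace` supported on `K`. -/
def supportedSpace (K : Finset X) : Submodule ℝ G.GradientSpace where
  carrier := {w | w ∈ G.neumannSpace ∧ ∀ x ∉ K, G.gradientFst w x = 0}
  add_mem' {w v} hw hv := ⟨add_mem hw.1 hv.1, fun x hx => by
    rw [map_add, add_apply, hw.2 x hx, hv.2 x hx, add_zero]⟩
  zero_mem' := ⟨zero_mem _, fun x _ => by rw [map_zero, zero_apply]⟩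
  smul_mem' a w hw := ⟨Submodule.smul_mem _ a hw.1, fun x hx => by
    rw [map_smul, smul_apply, hw.2 x hx, mul_zero]⟩

theorem isClosed_supportedSpace (K : Finset X) :
    IsClosed (G.supportedSpace K : Set G.GradientSpace) := by
  have h : (G.supportedSpace K : Set G.GradientSpace) = (G.neumannSpace : Set G.GradientSpace) ∩
      ⋂ x ∈ (K : Set X)ᶜ, {w : G.GradientSpace | G.gradientFst w x = 0} := by
    ext w
    simp only [Set.mem_inter_iff, Set.mem_iInter]
    rfl
  rw [h]
  exact G.isClosed_neumannSpace.inter (isClosed_biInter fun x _ =>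
    isClosed_eq (continuous_gradientFst_apply x) continuous_const)

instance : CompleteSpace G.neumannSpace := G.isClosed_neumannSpace.completeSpace_coe

instance (K : Finset X) : CompleteSpace (G.supportedSpace K) :=
  (G.isClosed_supportedSpace K).completeSpace_coe

/-- The closure of the functions supported on some `K k`. -/
def dirichletSpace (K : ℕ → Finset X) : Submodule ℝ G.GradientSpace :=
  (⨆ k, G.supportedSpace (K k)).topologicalClosure

instance (K : ℕ → Finset X) : CompleteSpace (G.dirichletSpace K) :=
  (Submodule.isClosed_topologicalClosure _).completeSpace_coe

theorem dirichletSpace_le_neumannSpace (K : ℕ → Finset X) :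
    G.dirichletSpace K ≤ G.neumannSpace :=
  Submodule.topologicalClosure_minimal _ (iSup_le fun _ _ hw => hw.1) G.isClosed_neumannSpace

theorem supportedSpace_mono {K : ℕ → Finset X} (hK : Monotone K) :
    Monotone fun k => G.supportedSpace (K k) :=
  fun _ _ hkl _ hw => ⟨hw.1, fun x hx => hw.2 x fun h => hx (hK hkl h)⟩

variable {G}

/-- On `neumannSpace` the norm is the form norm, and each finite support lies in some `K k`, so the
two closures coincide. -/
theorem represents_dirichletForm {K : ℕ → Finset X} (hK : G.IsExhaustion K) :
    G.dirichletForm.Represents G.gradientFst (G.dirichletSpace K) := by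
  refine ⟨fun w hw => ?_, fun f hf => ?_⟩
  · have hwN := G.dirichletSpace_le_neumannSpace K hw
    refine ⟨⟨gradientFst_mem_neumannDomain hwN, fun ε hε => ?_⟩, fun w' hw' _ =>
      inner_eq_energy hwN (G.dirichletSpace_le_neumannSpace K hw')⟩
    obtain ⟨v, hv, hwv⟩ := Metric.mem_closure_iff.1 hw (√ε) (Real.sqrt_pos.2 hε)
    obtain ⟨k, hk⟩ := (Submodule.mem_iSup_of_directed _
      (G.supportedSpace_mono hK.monotone).directed_le).1 hv
    refine ⟨G.gradientFst v, (K k).finite_toSet.subset fun x hx => ?_, ?_⟩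
    · by_contra h
      exact hx (hk.2 x h)
    · rw [← map_sub, ← norm_sq_eq_formNormSq (sub_mem hwN hk.1), ← dist_eq_norm]
      exact (Real.lt_sqrt dist_nonneg).1 hwv
  · obtain ⟨w, hw, rfl⟩ := exists_lift hf.1
    refine ⟨w, Metric.mem_closure_iff.2 fun ε hε => ?_, rfl⟩
    obtain ⟨φ, hφ, hd⟩ := hf.2 (ε ^ 2) (by positivity)
    obtain ⟨v, hv, rfl⟩ := exists_lift (G.finitelySupported_mem_neumannDomain hφ)
    obtain ⟨k, hk⟩ := (tendsto_atTop.1 hK.tendsto_atTop hφ.toFinset).exists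
    refine ⟨v, Submodule.mem_iSup_of_mem k ⟨hv, fun x hx => ?_⟩, ?_⟩
    · by_contra h
      exact hx (hk (hφ.mem_toFinset.2 h))
    · rw [← map_sub, ← norm_sq_eq_formNormSq (sub_mem hw hv), ← dist_eq_norm] at hd
      exact lt_of_pow_lt_pow_left₀ 2 hε.le hd

theorem eq_zero_of_inner_gradientFst {F : Submodule ℝ G.GradientSpace}
    (hF : ∀ x, ∃ w ∈ F, G.gradientFst w = delta G x) (h : G.Ell2)
    (h0 : ∀ w ∈ F, inner ℝ h (G.gradientFst w) = 0) : h = 0 := by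
  ext x
  obtain ⟨w, hw, hwx⟩ := hF x
  rw [apply_eq_inner, ← hwx, h0 w hw, mul_zero, zero_apply]

theorem exists_lift_delta (x : X) : ∃ w ∈ G.neumannSpace, G.gradientFst w = delta G x :=
  exists_lift (G.finitelySupported_mem_neumannDomain (finitelySupported_extendZero _ _))

theorem exists_lift_delta_dirichlet {K : ℕ → Finset X} (hK : G.IsExhaustion K) (x : X) :
    ∃ w ∈ G.dirichletSpace K, G.gradientFst w = delta G x := by
  obtain ⟨w, hw, hwx⟩ := exists_lift_delta (G := G) x
  obtain ⟨k, hk⟩ := hK.exhaust x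
  refine ⟨w, Submodule.le_topologicalClosure _ (Submodule.mem_iSup_of_mem k ⟨hw, fun y hy => ?_⟩),
    hwx⟩
  rw [hwx, delta_of_ne]
  rintro rfl
  exact hy hk

end GraphOver

/-! ### Energy and Laplacians on finite vertex sets -/

namespace GraphOver

variable {X : Type*} (G : GraphOver X)

open Ell2 FiniteSpectralData PartialForm

/-- The energy form of the graph induced on `K`. -/
def restrictedEnergy (K : Finset X) (f g : X → ℝ) : ℝ :=
  1 / 2 * ∑ p ∈ K ×ˢ K, G.b p.1 p.2 * ((f p.1 - f p.2) * (g p.1 - g p.2)) +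
    ∑ x ∈ K, G.c x * (f x * g x)

theorem restrictedEnergy_congr {K : Finset X} {f f' : X → ℝ} (h : ∀ x ∈ K, f x = f' x)
    (g : X → ℝ) : G.restrictedEnergy K f g = G.restrictedEnergy K f' g := by
  unfold restrictedEnergy
  congr 1
  · congr 1
    refine Finset.sum_congr rfl fun p hp => ?_
    rw [Finset.mem_product] at hp
    rw [h _ hp.1, h _ hp.2]
  · exact Finset.sum_congr rfl fun x hx => by rw [h x hx]

theorem restrictedEnergy_comm (K : Finset X) (f g : X → ℝ) :
    G.restrictedEnergy K f g = G.restrictedEnergy K g f := by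
  simp only [restrictedEnergy, mul_comm]

theorem restrictedEnergy_self_nonneg (K : Finset X) (f : X → ℝ) : 0 ≤ G.restrictedEnergy K f f :=
  add_nonneg (mul_nonneg (by norm_num) (Finset.sum_nonneg fun p _ =>
    mul_nonneg (G.b_nonneg _ _) (mul_self_nonneg _)))
    (Finset.sum_nonneg fun x _ => mul_nonneg (G.c_nonneg x) (mul_self_nonneg _))

theorem restrictedEnergy_self_mono {K K' : Finset X} (h : K ⊆ K') (f : X → ℝ) :
    G.restrictedEnergy K f f ≤ G.restrictedEnergy K' f f := by
  refine add_le_add (mul_le_mul_of_nonneg_left ?_ (by norm_num)) ?_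
  · exact Finset.sum_le_sum_of_subset_of_nonneg (Finset.product_subset_product h h)
      fun p _ _ => mul_nonneg (G.b_nonneg _ _) (mul_self_nonneg _)
  · exact Finset.sum_le_sum_of_subset_of_nonneg h
      fun x _ _ => mul_nonneg (G.c_nonneg _) (mul_self_nonneg _)

theorem restrictedEnergy_add_self (K : Finset X) (f g : X → ℝ) :
    G.restrictedEnergy K (fun x => f x + g x) (fun x => f x + g x) =
      G.restrictedEnergy K f f + 2 * G.restrictedEnergy K f g + G.restrictedEnergy K g g := by
  have h1 : ∑ p ∈ K ×ˢ K, G.b p.1 p.2 * ((f p.1 + g p.1 - (f p.2 + g p.2)) *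
      (f p.1 + g p.1 - (f p.2 + g p.2))) =
      ∑ p ∈ K ×ˢ K, G.b p.1 p.2 * ((f p.1 - f p.2) * (f p.1 - f p.2)) +
      2 * ∑ p ∈ K ×ˢ K, G.b p.1 p.2 * ((f p.1 - f p.2) * (g p.1 - g p.2)) +
      ∑ p ∈ K ×ˢ K, G.b p.1 p.2 * ((g p.1 - g p.2) * (g p.1 - g p.2)) := by
    rw [Finset.mul_sum, ← Finset.sum_add_distrib, ← Finset.sum_add_distrib]
    exact Finset.sum_congr rfl fun p _ => by ring
  have h2 : ∑ x ∈ K, G.c x * ((f x + g x) * (f x + g x)) =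
      ∑ x ∈ K, G.c x * (f x * f x) + 2 * ∑ x ∈ K, G.c x * (f x * g x) +
      ∑ x ∈ K, G.c x * (g x * g x) := by
    rw [Finset.mul_sum, ← Finset.sum_add_distrib, ← Finset.sum_add_distrib]
    exact Finset.sum_congr rfl fun p _ => by ring
  unfold restrictedEnergy
  rw [h1, h2]
  ring

theorem sum_restrictedLaplacian_mul (K : Finset X) (f g : X → ℝ) :
    ∑ x : K, G.m x * (G.restrictedLaplacian K (fun y : K => f y) x * g x) =
      G.restrictedEnergy K f g := by
  have h1 : ∀ x : K, G.m x * (G.restrictedLaplacian K (fun y : K => f y) x * g x) =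
      ∑ y ∈ K, G.b x y * ((f x - f y) * g x) + G.c x * (f x * g x) := by
    intro x
    change G.m x * ((1 / G.m x * ∑ y : K, G.b x y * (f x - f y) + G.c x / G.m x * f x) * g x) = _
    rw [Finset.sum_coe_sort K fun y => G.b x y * (f x - f y)]
    have : ∑ y ∈ K, G.b x y * ((f x - f y) * g x) = (∑ y ∈ K, G.b x y * (f x - f y)) * g x := by
      rw [Finset.sum_mul]
      exact Finset.sum_congr rfl fun y _ => by ring
    rw [this]
    have := (G.m_pos x).ne'
    field_simp
  rw [Finset.sum_congr rfl fun x _ => h1 x, Finset.sum_add_distrib,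
    Finset.sum_coe_sort K fun x => ∑ y ∈ K, G.b x y * ((f x - f y) * g x),
    Finset.sum_coe_sort K fun x => G.c x * (f x * g x), restrictedEnergy, Finset.sum_product]
  congr 1
  -- Green's formula: exchanging `x` and `y` flips the sign of `f x - f y`, so both halves of the
  -- energy contribute equally.
  have h2 : ∑ x ∈ K, ∑ y ∈ K, G.b x y * ((f x - f y) * g x) =
      -∑ x ∈ K, ∑ y ∈ K, G.b x y * ((f x - f y) * g y) := by
    rw [Finset.sum_comm, ← Finset.sum_neg_distrib]
    refine Finset.sum_congr rfl fun x _ => ?_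
    rw [← Finset.sum_neg_distrib]
    refine Finset.sum_congr rfl fun y _ => ?_
    rw [G.b_symm]
    ring
  have h3 : ∑ x ∈ K, ∑ y ∈ K, G.b x y * ((f x - f y) * (g x - g y)) =
      ∑ x ∈ K, ∑ y ∈ K, G.b x y * ((f x - f y) * g x) -
      ∑ x ∈ K, ∑ y ∈ K, G.b x y * ((f x - f y) * g y) := by
    rw [← Finset.sum_sub_distrib]
    refine Finset.sum_congr rfl fun x _ => ?_
    rw [← Finset.sum_sub_distrib]
    exact Finset.sum_congr rfl fun y _ => by ring
  rw [h3]
  linarith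

theorem sum_restrictedLaplacian_mul' (K : Finset X) (f g : K → ℝ) :
    ∑ x : K, G.m x * (G.restrictedLaplacian K f x * g x) =
      G.restrictedEnergy K (extendZero K f : G.Ell2) (extendZero K g : G.Ell2) := by
  rw [← sum_restrictedLaplacian_mul]
  simp only [extendZero_apply_coe]

theorem exists_diagonalizes_restrictedLaplacian (K : Finset X) :
    ∃ S : FiniteSpectralData G.Ell2, Diagonalizes K (G.restrictedLaplacian K) S := by
  refine exists_diagonalizes K _ (fun f g => ?_) fun f => ?_
  · have h : ∀ x : K, G.m x * (f x * G.restrictedLaplacian K g x) =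
        G.m x * (G.restrictedLaplacian K g x * f x) := fun x => by ring
    simp only [h]
    rw [sum_restrictedLaplacian_mul', sum_restrictedLaplacian_mul', restrictedEnergy_comm]
  · rw [sum_restrictedLaplacian_mul']
    exact G.restrictedEnergy_self_nonneg K _

/-! ### The Dirichlet restrictions -/

/-- The rate at which the Dirichlet restriction to `K` is killed through edges leaving `K`. -/
def exitRate (K : Finset X) (x : X) : ℝ := 1 / G.m x * (∑' y, G.b x y - ∑ y ∈ K, G.b x y)

theorem exitRate_nonneg (K : Finset X) (x : X) : 0 ≤ G.exitRate K x :=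
  mul_nonneg (one_div_nonneg.2 (G.m_pos x).le)
    (sub_nonneg.2 ((G.b_summable x).sum_le_tsum K fun y _ => G.b_nonneg x y))

/-- The Dirichlet restriction of the Laplacian to the finite set `K`. -/
def dirichletLaplacian (K : Finset X) : (K → ℝ) →ₗ[ℝ] (K → ℝ) :=
  G.restrictedLaplacian K + LinearMap.pi fun x : K => G.exitRate K x • LinearMap.proj x

theorem dirichletLaplacian_apply (K : Finset X) (f : K → ℝ) (x : K) :
    G.dirichletLaplacian K f x = G.restrictedLaplacian K f x + G.exitRate K x * f x := rfl

/-- The exit rate restores the full vertex degree on the diagonal, so this is the formal Laplacian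
applied to the extension of `f` by zero. -/
theorem dirichletLaplacian_apply_eq (K : Finset X) (f : K → ℝ) (x : K) :
    G.m x * G.dirichletLaplacian K f x =
      (∑' y, G.b x y) * f x - ∑ y : K, G.b x y * f y + G.c x * f x := by
  rw [dirichletLaplacian_apply, exitRate]
  change G.m x * (1 / G.m x * ∑ y : K, G.b x y * (f x - f y) + G.c x / G.m x * f x +
    1 / G.m x * (∑' y, G.b x y - ∑ y ∈ K, G.b x y) * f x) = _
  have h1 : ∑ y : K, G.b x y * (f x - f y) =
      (∑ y ∈ K, G.b x y) * f x - ∑ y : K, G.b x y * f y := by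
    rw [← Finset.sum_coe_sort K, Finset.sum_mul, ← Finset.sum_sub_distrib]
    exact Finset.sum_congr rfl fun y _ => by ring
  rw [h1]
  have := (G.m_pos x).ne'
  field_simp
  ring

theorem exists_diagonalizes_dirichletLaplacian (K : Finset X) :
    ∃ S : FiniteSpectralData G.Ell2, Diagonalizes K (G.dirichletLaplacian K) S := by
  have h0 : ∀ f g : K → ℝ, ∑ x : K, G.m x * (G.dirichletLaplacian K f x * g x) =
      G.restrictedEnergy K (extendZero K f : G.Ell2) (extendZero K g : G.Ell2) +
        ∑ x : K, G.m x * G.exitRate K x * (f x * g x) := fun f g => by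
    rw [← sum_restrictedLaplacian_mul', ← Finset.sum_add_distrib]
    exact Finset.sum_congr rfl fun x _ => by rw [dirichletLaplacian_apply]; ring
  refine exists_diagonalizes K _ (fun f g => ?_) fun f => ?_
  · have h : ∀ x : K, G.m x * (f x * G.dirichletLaplacian K g x) =
        G.m x * (G.dirichletLaplacian K g x * f x) := fun x => by ring
    simp only [h]
    rw [h0, h0, restrictedEnergy_comm]
    congr 1
    exact Finset.sum_congr rfl fun x _ => by ring
  · rw [h0]
    exact add_nonneg (G.restrictedEnergy_self_nonneg K _) (Finset.sum_nonneg fun x _ =>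
      mul_nonneg (mul_nonneg (G.m_pos x).le (G.exitRate_nonneg K x)) (mul_self_nonneg _))

variable {G}

/-! ### The energy of a function against a finitely supported function -/

/-- Compare with `b x y * ((f x - f y)² + 1)`, using finite energy and summability of `b x`. -/
theorem summable_mul_sub {f : X → ℝ} (hf : G.FiniteEnergy f) (x : X) :
    Summable fun y => G.b x y * (f x - f y) := by
  have h1 : Summable fun y => G.b x y * (f x - f y) ^ 2 :=
    hf.1.comp_injective (i := fun y => (x, y)) fun y z h => (Prod.mk.inj h).2
  refine Summable.of_norm_bounded (h1.add (G.b_summable x)) fun y => ?_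
  rw [Real.norm_eq_abs, abs_mul, abs_of_nonneg (G.b_nonneg x y)]
  have h2 : |f x - f y| ≤ (f x - f y) ^ 2 + 1 := by
    rw [abs_le]
    constructor <;> nlinarith [sq_nonneg (f x - f y - 1), sq_nonneg (f x - f y + 1)]
  nlinarith [mul_le_mul_of_nonneg_left h2 (G.b_nonneg x y)]

/-- Green's formula: splitting `φ x - φ y` yields the family `A` and its transpose, each summable
because `φ` has finite support, with equal sums by symmetry of `b`. -/
theorem energy_eq_sum {f φ : X → ℝ} (hf : G.FiniteEnergy f) {K : Finset X}
    (hφ0 : ∀ x ∉ K, φ x = 0) :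
    G.energy f φ = ∑ x ∈ K, (∑' y, G.b x y * (f x - f y) + G.c x * f x) * φ x := by
  set A : X × X → ℝ := fun p => G.b p.1 p.2 * (f p.1 - f p.2) * φ p.1 with hA
  have hAs : Summable A := by
    refine Summable.of_norm ((summable_prod_of_nonneg fun p => norm_nonneg _).2 ⟨fun x => ?_, ?_⟩)
    · exact ((summable_mul_sub hf x).mul_right (φ x)).norm
    · refine summable_of_ne_finset_zero (s := K) fun x hx => ?_
      simp [hA, hφ0 x hx]
  have hAsum : ∑' p, A p = ∑ x ∈ K, (∑' y, G.b x y * (f x - f y)) * φ x := by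
    rw [hAs.tsum_prod' fun x => (summable_mul_sub hf x).mul_right (φ x),
      tsum_eq_sum (s := K) fun x hx => by simp [hA, hφ0 x hx]]
    refine Finset.sum_congr rfl fun x _ => ?_
    simp only [hA]
    exact tsum_mul_right
  have hA' : ∑' p : X × X, A p.swap = ∑' p, A p := (Equiv.prodComm X X).tsum_eq A
  have hAs' : Summable fun p : X × X => A p.swap := (Equiv.prodComm X X).summable_iff.2 hAs
  have h1 : ∑' p : X × X, G.b p.1 p.2 * ((f p.1 - f p.2) * (φ p.1 - φ p.2)) =
      2 * ∑' p, A p := by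
    rw [two_mul]
    nth_rewrite 2 [← hA']
    rw [← hAs.tsum_add hAs']
    refine tsum_congr fun p => ?_
    simp only [hA, Prod.fst_swap, Prod.snd_swap, G.b_symm p.2 p.1]
    ring
  have h2 : ∑' x, G.c x * (f x * φ x) = ∑ x ∈ K, G.c x * (f x * φ x) :=
    tsum_eq_sum fun x hx => by rw [hφ0 x hx, mul_zero, mul_zero]
  rw [energy, h1, h2, hAsum, ← mul_assoc, one_div_mul_cancel two_ne_zero, one_mul,
    ← Finset.sum_add_distrib]
  exact Finset.sum_congr rfl fun x _ => by ring

theorem energy_extendZero {f : X → ℝ} (hf : G.FiniteEnergy f) (K : Finset X) (g : K → ℝ) :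
    G.energy f (extendZero K g : G.Ell2) =
      ∑ x : K, (∑' y, G.b x y * (f x - f y) + G.c x * f x) * g x := by
  rw [energy_eq_sum hf fun x hx => extendZero_apply_notMem K g hx, ← Finset.sum_coe_sort]
  exact Finset.sum_congr rfl fun x _ => by rw [extendZero_apply_coe]

theorem energy_delta {f : X → ℝ} (hf : G.FiniteEnergy f) (x : X) :
    G.energy f (delta G x) = ∑' y, G.b x y * (f x - f y) + G.c x * f x := by
  rw [delta, energy_extendZero hf]
  simp

theorem energy_extendZero_extendZero (K : Finset X) (f g : K → ℝ) :
    G.energy (extendZero K f : G.Ell2) (extendZero K g : G.Ell2) =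
      ∑ x : K, G.m x * (G.dirichletLaplacian K f x * g x) := by
  rw [energy_extendZero (G.finitelySupported_mem_neumannDomain (finitelySupported_extendZero K f))]
  refine Finset.sum_congr rfl fun x _ => ?_
  rw [← mul_assoc, dirichletLaplacian_apply_eq, extendZero_apply_coe]
  congr 2
  have h1 : Summable fun y => G.b x y * (extendZero K f : G.Ell2) y :=
    summable_of_ne_finset_zero (s := K) fun y hy => by
      rw [extendZero_apply_notMem K f hy, mul_zero]
  have h2 : ∑' y, G.b x y * (extendZero K f : G.Ell2) y = ∑ y : K, G.b x y * f y := by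
    rw [tsum_eq_sum (s := K) fun y hy => by rw [extendZero_apply_notMem K f hy, mul_zero],
      ← Finset.sum_coe_sort]
    exact Finset.sum_congr rfl fun y _ => by rw [extendZero_apply_coe]
  rw [← h2, ← tsum_mul_right, ← ((G.b_summable x).mul_right (f x)).tsum_sub h1]
  exact tsum_congr fun y => by ring

/-! ### Convergence of the resolvents -/

/-- For functions supported on `K` the energy is the form of the Dirichlet Laplacian, so the
solution of `(L + 1)ρ = h` on `K` solves the weak equation. -/
theorem formResolvent_supportedSpace {K : Finset X} {S : FiniteSpectralData G.Ell2}
    (hS : Diagonalizes K (G.dirichletLaplacian K) S) (h : G.Ell2) :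
    formResolvent G.gradientFst (G.supportedSpace K) h = S.apply resolventFun h := by
  obtain ⟨ρ, hρ1, hρ2⟩ := hS.resolvent h
  obtain ⟨w, hw, hwρ⟩ := exists_lift (G.finitelySupported_mem_neumannDomain
    (finitelySupported_extendZero (G := G) K ρ))
  have hwK : w ∈ G.supportedSpace K :=
    ⟨hw, fun x hx => by rw [hwρ, extendZero_apply_notMem K ρ hx]⟩
  have key := eq_starProjection_adjoint (j := G.gradientFst) (h := h) hwK fun v hv => by
    rw [inner_eq_energy hw hv.1, ← extendZero_restrict hv.2, hwρ, energy_extendZero_extendZero,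
      inner_extendZero_extendZero, inner_extendZero_right, ← Finset.sum_add_distrib]
    refine Finset.sum_congr rfl fun x _ => ?_
    have h1 : G.dirichletLaplacian K ρ x + ρ x = h x := congrFun hρ2 x
    rw [← h1]
    ring
  rw [hρ1, ← hwρ, ← key]
  rfl

/-- Orthogonal projections onto increasing subspaces converge strongly to the projection onto the
closure of the union. -/
theorem tendsto_dirichlet_resolvent {K : ℕ → Finset X} (hK : G.IsExhaustion K)
    {S : ℕ → FiniteSpectralData G.Ell2}
    (hS : ∀ k, Diagonalizes (K k) (G.dirichletLaplacian (K k)) (S k)) (h : G.Ell2) :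
    Tendsto (fun k => (S k).apply resolventFun h) atTop
      (𝓝 (formResolvent G.gradientFst (G.dirichletSpace K) h)) := by
  have : (⨆ k, G.supportedSpace (K k)).topologicalClosure.HasOrthogonalProjection :=
    inferInstanceAs (G.dirichletSpace K).HasOrthogonalProjection
  have h1 := Submodule.starProjection_tendsto_closure_iSup (fun k => G.supportedSpace (K k))
    (G.supportedSpace_mono hK.monotone) (ContinuousLinearMap.adjoint G.gradientFst h)
  have h2 := (G.gradientFst.continuous.tendsto _).comp h1
  refine h2.congr fun k => ?_
  rw [← formResolvent_supportedSpace (hS k)]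
  rfl

end GraphOver

/-! ### Convergence of the Neumann resolvents -/

namespace GraphOver

variable {X : Type*} {G : GraphOver X}

open Ell2 FiniteSpectralData PartialForm

theorem restrictedEnergy_le_energy {f : X → ℝ} (hf : G.FiniteEnergy f) (K : Finset X) :
    G.restrictedEnergy K f f ≤ G.energy f f := by
  refine add_le_add (mul_le_mul_of_nonneg_left ?_ (by norm_num)) ?_
  · refine Summable.sum_le_tsum _ (fun p _ => mul_nonneg (G.b_nonneg _ _) (mul_self_nonneg _)) ?_
    simpa only [sq] using hf.1
  · refine Summable.sum_le_tsum _ (fun x _ => mul_nonneg (G.c_nonneg _) (mul_self_nonneg _)) ?_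
    simpa only [sq] using hf.2

theorem finiteEnergy_of_restrictedEnergy_le {K : ℕ → Finset X} (hK : G.IsExhaustion K)
    {f : X → ℝ} {C : ℝ} (h : ∀ k, G.restrictedEnergy (K k) f f ≤ C) :
    G.FiniteEnergy f ∧ G.energy f f ≤ C := by
  have hb : ∀ s : Finset (X × X), 0 ≤ ∑ p ∈ s, G.b p.1 p.2 * ((f p.1 - f p.2) * (f p.1 - f p.2)) :=
    fun s => Finset.sum_nonneg fun p _ => mul_nonneg (G.b_nonneg _ _) (mul_self_nonneg _)
  have hc : ∀ s : Finset X, 0 ≤ ∑ x ∈ s, G.c x * (f x * f x) :=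
    fun s => Finset.sum_nonneg fun p _ => mul_nonneg (G.c_nonneg _) (mul_self_nonneg _)
  have hprod : Tendsto (fun k => K k ×ˢ K k) atTop atTop := by
    refine tendsto_atTop_finset_of_monotone
      (fun k l hkl => Finset.product_subset_product (hK.monotone hkl) (hK.monotone hkl)) fun p => ?_
    obtain ⟨k, hk⟩ := hK.exhaust p.1
    obtain ⟨l, hl⟩ := hK.exhaust p.2
    exact ⟨max k l, Finset.mem_product.2 ⟨hK.monotone (le_max_left k l) hk,
      hK.monotone (le_max_right k l) hl⟩⟩
  have h1 : Summable fun p : X × X => G.b p.1 p.2 * ((f p.1 - f p.2) * (f p.1 - f p.2)) := by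
    -- The `2` undoes the factor `1/2` in front of the edge sum.
    refine summable_of_sum_le (c := 2 * C)
      (fun p => mul_nonneg (G.b_nonneg _ _) (mul_self_nonneg _)) fun s => ?_
    obtain ⟨k, hk⟩ := (tendsto_atTop.1 hprod s).exists
    refine (Finset.sum_le_sum_of_subset_of_nonneg hk
      fun p _ _ => mul_nonneg (G.b_nonneg _ _) (mul_self_nonneg _)).trans ?_
    have h2 := h k
    rw [restrictedEnergy] at h2
    linarith [hc (K k)]
  have h2 : Summable fun x => G.c x * (f x * f x) := by
    refine summable_of_sum_le (c := C)
      (fun p => mul_nonneg (G.c_nonneg _) (mul_self_nonneg _)) fun s => ?_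
    obtain ⟨k, hk⟩ := (tendsto_atTop.1 hK.tendsto_atTop s).exists
    refine (Finset.sum_le_sum_of_subset_of_nonneg hk
      fun p _ _ => mul_nonneg (G.c_nonneg _) (mul_self_nonneg _)).trans ?_
    have h2 := h k
    rw [restrictedEnergy] at h2
    linarith [hb (K k ×ˢ K k)]
  refine ⟨⟨by simpa only [sq] using h1, by simpa only [sq] using h2⟩, ?_⟩
  exact le_of_tendsto (((h1.hasSum.comp hprod).const_mul (1 / 2)).add
    (h2.hasSum.comp hK.tendsto_atTop)) (Eventually.of_forall h)

theorem tendsto_restrictedEnergy (K : Finset X) {u : ℕ → G.Ell2} {f : G.Ell2}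
    (hu : Tendsto u atTop (𝓝 f)) :
    Tendsto (fun k => G.restrictedEnergy K (u k) (u k)) atTop (𝓝 (G.restrictedEnergy K f f)) := by
  have h := tendsto_apply hu
  refine ((tendsto_finsetSum _ fun p _ => ?_).const_mul _).add (tendsto_finsetSum _ fun x _ => ?_)
  · exact (((h p.1).sub (h p.2)).mul ((h p.1).sub (h p.2))).const_mul _
  · exact ((h x).mul (h x)).const_mul _

/-- Completing the square: `u` minimizes `v ↦ q_K(v) + ‖v - h‖²`, where `q_K` is the energy form of
the graph induced on `K`. -/
theorem Diagonalizes.restrictedEnergy_add {K : Finset X} {S : FiniteSpectralData G.Ell2}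
    (hS : Diagonalizes K (G.restrictedLaplacian K) S) (h : G.Ell2) {u : G.Ell2}
    (hu : u = S.apply resolventFun h + (h - extendZero K fun x => h x)) (v : G.Ell2) :
    G.restrictedEnergy K v v + ‖v - h‖ ^ 2 = G.restrictedEnergy K u u + ‖u - h‖ ^ 2 +
      (G.restrictedEnergy K (v - u : G.Ell2) (v - u : G.Ell2) + ‖v - u‖ ^ 2) := by
  obtain ⟨ρ, hρ1, hρ2⟩ := hS.resolvent h
  have hρ3 : ∀ x : K, G.restrictedLaplacian K ρ x + ρ x = h x := fun x => congrFun hρ2 x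
  have huK : ∀ x ∈ K, u x = (extendZero K ρ : G.Ell2) x := fun x hx => by
    rw [hu, hρ1, add_apply, sub_apply, extendZero_apply_mem K (fun x : K => h x) hx, sub_self,
      add_zero]
  -- The Euler–Lagrange equation. It holds for all `d`, not only those supported on `K`, because `u`
  -- equals `h` off `K`.
  have hweak : ∀ d : G.Ell2, G.restrictedEnergy K u d + inner ℝ (u - h) d = 0 := by
    intro d
    have h1 : u - h = (extendZero K ρ : G.Ell2) - extendZero K fun x => h x := by
      rw [hu, hρ1]
      abel
    rw [G.restrictedEnergy_congr huK, ← sum_restrictedLaplacian_mul, h1, inner_sub_left,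
      real_inner_comm, real_inner_comm d, inner_extendZero_right, inner_extendZero_right,
      ← Finset.sum_sub_distrib, ← Finset.sum_add_distrib]
    refine Finset.sum_eq_zero fun x _ => ?_
    simp only [extendZero_apply_coe]
    rw [← hρ3 x]
    ring
  have h1 : G.restrictedEnergy K v v = G.restrictedEnergy K u u +
      2 * G.restrictedEnergy K u (v - u : G.Ell2) +
      G.restrictedEnergy K (v - u : G.Ell2) (v - u : G.Ell2) := by
    rw [← restrictedEnergy_add_self]
    congr 1 <;> funext x <;> rw [sub_apply] <;> ring
  have h2 : ‖v - h‖ ^ 2 = ‖u - h‖ ^ 2 + 2 * inner ℝ (u - h) (v - u) + ‖v - u‖ ^ 2 := by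
    rw [← norm_add_sq_real, sub_add_sub_comm, add_comm u v, add_sub_add_right_eq_sub]
  have h3 := hweak (v - u)
  rw [h1, h2]
  linarith

/-- The resolvents on `K k`, completed by `h` outside, minimize `v ↦ q_k(v) + ‖v - h‖²` over all of
`ℓ²`. As `q_k` increases with `k`, the minima `a k` increase, and they are bounded by the minimum
for the full energy, attained at `u₀`. Completing the square bounds `‖u l - u k‖²` by `a l - a k`,
so the minimizers converge; their limit has finite energy and is again a minimizer for the full
energy, hence equals `u₀`. -/
theorem tendsto_neumann_resolvent {K : ℕ → Finset X} (hK : G.IsExhaustion K)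
    {S : ℕ → FiniteSpectralData G.Ell2}
    (hS : ∀ k, Diagonalizes (K k) (G.restrictedLaplacian (K k)) (S k)) (h : G.Ell2) :
    Tendsto (fun k => (S k).apply resolventFun h) atTop
      (𝓝 (formResolvent G.gradientFst G.neumannSpace h)) := by
  set w₀ := G.neumannSpace.starProjection (ContinuousLinearMap.adjoint G.gradientFst h) with hw₀
  have hw₀F : w₀ ∈ G.neumannSpace := Submodule.starProjection_apply_mem _ _
  have hw₀D := gradientFst_mem_neumannDomain hw₀F
  set u₀ := G.gradientFst w₀ with hu₀
  change Tendsto _ _ (𝓝 u₀)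
  have hmin : ∀ w ∈ G.neumannSpace, G.energy (G.gradientFst w) (G.gradientFst w) +
      ‖G.gradientFst w - h‖ ^ 2 = G.energy u₀ u₀ + ‖u₀ - h‖ ^ 2 + ‖w - w₀‖ ^ 2 := by
    have hE : ∀ w ∈ G.neumannSpace, G.energy (G.gradientFst w) (G.gradientFst w) +
        ‖G.gradientFst w - h‖ ^ 2 = ‖w‖ ^ 2 - 2 * inner ℝ w₀ w + ‖h‖ ^ 2 := fun w hw => by
      rw [norm_sq_eq_formNormSq hw, formNormSq, norm_sub_sq_real, hw₀,
        inner_starProjection_adjoint h hw, real_inner_comm h]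
      ring
    intro w hw
    rw [hE w hw, hE w₀ hw₀F, norm_sub_sq_real, real_inner_self_eq_norm_sq, real_inner_comm w₀]
    ring
  set u : ℕ → G.Ell2 := fun k =>
    (S k).apply resolventFun h + (h - extendZero (K k) fun x => h x) with hu
  set a : ℕ → ℝ := fun k => G.restrictedEnergy (K k) (u k) (u k) + ‖u k - h‖ ^ 2 with ha
  have hid : ∀ k (v : G.Ell2), G.restrictedEnergy (K k) v v + ‖v - h‖ ^ 2 = a k +
      (G.restrictedEnergy (K k) (v - u k : G.Ell2) (v - u k : G.Ell2) + ‖v - u k‖ ^ 2) :=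
    fun k v => (hS k).restrictedEnergy_add h rfl v
  have hle : ∀ k (v : G.Ell2), a k + ‖v - u k‖ ^ 2 ≤ G.restrictedEnergy (K k) v v + ‖v - h‖ ^ 2 := by
    intro k v
    rw [hid k v]
    linarith [G.restrictedEnergy_self_nonneg (K k) (v - u k : G.Ell2)]
  have hmono : ∀ k l, k ≤ l → G.restrictedEnergy (K k) (u l) (u l) + ‖u l - h‖ ^ 2 ≤ a l :=
    fun k l hkl => add_le_add (G.restrictedEnergy_self_mono (hK.monotone hkl) _) le_rfl
  have hcauchy : ∀ k l, k ≤ l → ‖u l - u k‖ ^ 2 ≤ a l - a k := fun k l hkl => by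
    linarith [hle k (u l), hmono k l hkl]
  have hamono : Monotone a := fun k l hkl => by
    linarith [hcauchy k l hkl, sq_nonneg ‖u l - u k‖]
  have habdd : ∀ k, a k ≤ G.energy u₀ u₀ + ‖u₀ - h‖ ^ 2 := fun k => by
    linarith [hle k u₀, restrictedEnergy_le_energy hw₀D (K k), sq_nonneg ‖u₀ - u k‖]
  have halim : Tendsto a atTop (𝓝 (⨆ k, a k)) :=
    tendsto_atTop_ciSup hamono ⟨_, Set.forall_mem_range.2 habdd⟩
  set A := ⨆ k, a k with hA
  have haA : ∀ k, a k ≤ A := hamono.ge_of_tendsto halim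
  have hAle : A ≤ G.energy u₀ u₀ + ‖u₀ - h‖ ^ 2 := le_of_tendsto' halim habdd
  have huc : CauchySeq u := by
    refine Metric.cauchySeq_iff'.2 fun ε hε => ?_
    obtain ⟨N, hN⟩ := ((tendsto_order.1 halim).1 (A - ε ^ 2) (by linarith [sq_pos_of_pos hε])).exists
    refine ⟨N, fun n hn => ?_⟩
    rw [dist_eq_norm]
    refine lt_of_pow_lt_pow_left₀ 2 hε.le ?_
    linarith [hcauchy N n hn, haA n]
  obtain ⟨f, hf⟩ := cauchySeq_tendsto_of_complete huc
  -- For fixed `k` only finitely many values of `u l` enter, so `l → ∞` is harmless; the limit in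
  -- `k` is taken afterwards.
  have hfle : ∀ k, G.restrictedEnergy (K k) f f ≤ A - ‖f - h‖ ^ 2 := by
    intro k
    have h1 : G.restrictedEnergy (K k) f f + ‖f - h‖ ^ 2 ≤ A := by
      refine le_of_tendsto ((tendsto_restrictedEnergy (K k) hf).add
        ((hf.sub_const h).norm.pow 2)) ?_
      filter_upwards [eventually_ge_atTop k] with l hl
      exact (hmono k l hl).trans (haA l)
    linarith
  obtain ⟨hfE, hfA⟩ := finiteEnergy_of_restrictedEnergy_le hK hfle
  obtain ⟨w, hw, rfl⟩ := exists_lift (f := f) hfE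
  have hww₀ : w = w₀ := by
    have h1 := hmin w hw
    have h2 : ‖w - w₀‖ ^ 2 = 0 := le_antisymm (by linarith) (sq_nonneg _)
    exact sub_eq_zero.1 (norm_eq_zero.1 (pow_eq_zero_iff two_ne_zero |>.1 h2))
  rw [hww₀] at hf
  -- The correction by `h` outside `K k` tends to zero in norm.
  have h3 := hf.sub ((tendsto_extendZero_restrict hK.tendsto_atTop h).const_sub h)
  rw [sub_self, sub_zero] at h3
  refine h3.congr fun k => ?_
  exact add_sub_cancel_right _ _

end GraphOver

namespace GraphOver

variable {X : Type*} {G : GraphOver X}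

open Ell2 FiniteSpectralData PartialForm

/-! ### The Dirichlet and Neumann semigroups as limits -/

theorem neumannResolvent_injective (h : G.Ell2)
    (h0 : formResolvent G.gradientFst G.neumannSpace h = 0) : h = 0 :=
  formResolvent_injective (eq_zero_of_inner_gradientFst exists_lift_delta) h h0

theorem dirichletResolvent_injective {K : ℕ → Finset X} (hK : G.IsExhaustion K) (h : G.Ell2)
    (h0 : formResolvent G.gradientFst (G.dirichletSpace K) h = 0) : h = 0 :=
  formResolvent_injective (eq_zero_of_inner_gradientFst (exists_lift_delta_dirichlet hK)) h h0

theorem isSemigroupOf_neumann {K : ℕ → Finset X} (hK : G.IsExhaustion K)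
    {S : ℕ → FiniteSpectralData G.Ell2}
    (hS : ∀ k, Diagonalizes (K k) (G.restrictedLaplacian (K k)) (S k)) :
    IsSemigroupOf G.neumannForm.operatorGraph G.neumannForm.semigroup ∧ ∀ t, 0 ≤ t → ∀ g,
      Tendsto (fun k => (S k).apply (heatFun t) g) atTop (𝓝 (G.neumannForm.semigroup t g)) :=
  G.represents_neumannForm.isSemigroupOf_and_tendsto norm_gradientFst_le
    (eq_zero_of_inner_gradientFst exists_lift_delta) (tendsto_neumann_resolvent hK hS)

theorem isSemigroupOf_dirichlet {K : ℕ → Finset X} (hK : G.IsExhaustion K)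
    {S : ℕ → FiniteSpectralData G.Ell2}
    (hS : ∀ k, Diagonalizes (K k) (G.dirichletLaplacian (K k)) (S k)) :
    IsSemigroupOf G.dirichletForm.operatorGraph G.dirichletForm.semigroup ∧ ∀ t, 0 ≤ t → ∀ g,
      Tendsto (fun k => (S k).apply (heatFun t) g) atTop (𝓝 (G.dirichletForm.semigroup t g)) :=
  (represents_dirichletForm hK).isSemigroupOf_and_tendsto norm_gradientFst_le
    (eq_zero_of_inner_gradientFst (exists_lift_delta_dirichlet hK)) (tendsto_dirichlet_resolvent hK hS)

/-- The Neumann restrictions to finite sets always approximate the Neumann semigroup. -/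
theorem tendsto_restrictedSemigroup {K : ℕ → Finset X} (hK : G.IsExhaustion K) {t : ℝ}
    (ht : 0 ≤ t) (f : G.Ell2) :
    Tendsto (fun k => G.restrictedSemigroup (K k) t f) atTop (𝓝 (G.neumannForm.semigroup t f)) := by
  choose S hS using fun k => G.exists_diagonalizes_restrictedLaplacian (K k)
  exact ((isSemigroupOf_neumann hK hS).2 t ht f).congr fun k => (hS k).heat t f

/-! ### Positivity and domination -/

theorem dirichletLaplacian_le (K : Finset X) :
    ∃ M : ℝ, ∀ f : K → ℝ, 0 ≤ f → G.dirichletLaplacian K f ≤ M • f := by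
  have hd : ∀ x, 0 ≤ (∑' y, G.b x y + G.c x) / G.m x := fun x =>
    div_nonneg (add_nonneg (tsum_nonneg (G.b_nonneg x)) (G.c_nonneg x)) (G.m_pos x).le
  -- The off-diagonal part is nonpositive, so any bound for the diagonal entries serves as `M`; here
  -- it is their sum.
  refine ⟨∑ x ∈ K, (∑' y, G.b x y + G.c x) / G.m x, fun f hf x => ?_⟩
  have h1 := G.dirichletLaplacian_apply_eq K f x
  have h2 : 0 ≤ ∑ y : K, G.b x y * f y :=
    Finset.sum_nonneg fun y _ => mul_nonneg (G.b_nonneg _ _) (hf y)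
  have h3 := Finset.single_le_sum (f := fun x => (∑' y, G.b x y + G.c x) / G.m x)
    (fun x _ => hd x) x.2
  have h4 : G.dirichletLaplacian K f x ≤ (∑' y, G.b x y + G.c x) / G.m x * f x := by
    rw [div_mul_eq_mul_div, le_div_iff₀ (G.m_pos x)]
    linarith
  exact h4.trans (mul_le_mul_of_nonneg_right h3 (hf x))

/-- On each `K k` the Dirichlet Laplacian exceeds the Neumann one by multiplication with the
nonnegative exit rate. The comparison of the exponentials passes to the limit pointwise. -/
theorem dirichlet_nonneg_and_le_neumann {K : ℕ → Finset X} (hK : G.IsExhaustion K) {t : ℝ}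
    (ht : 0 ≤ t) {f : G.Ell2} (hf : ∀ x, 0 ≤ f x) (x : X) :
    0 ≤ G.dirichletForm.semigroup t f x ∧
      G.dirichletForm.semigroup t f x ≤ G.neumannForm.semigroup t f x := by
  choose S hS using fun k => G.exists_diagonalizes_restrictedLaplacian (K k)
  choose S' hS' using fun k => G.exists_diagonalizes_dirichletLaplacian (K k)
  have hN := tendsto_apply ((isSemigroupOf_neumann hK hS).2 t ht f) x
  have hD := tendsto_apply ((isSemigroupOf_dirichlet hK hS').2 t ht f) x
  have key : ∀ k, 0 ≤ (S' k).apply (heatFun t) f x ∧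
      (S' k).apply (heatFun t) f x ≤ (S k).apply (heatFun t) f x := by
    intro k
    rw [(hS k).heat, (hS' k).heat]
    obtain ⟨M, hM⟩ := dirichletLaplacian_le (G := G) (K k)
    have h := exp_nonneg_and_le (ι := K k)
      (L := LinearMap.toContinuousLinearMap (G.restrictedLaplacian (K k)))
      (L' := LinearMap.toContinuousLinearMap (G.dirichletLaplacian (K k))) (M := M) ht hM
      (fun g hg y => by
        change _ ≤ G.restrictedLaplacian (K k) g y + G.exitRate (K k) y * g y
        exact le_add_of_nonneg_right (mul_nonneg (G.exitRate_nonneg _ _) (hg y)))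
      (f := fun y : K k => f y) fun y => hf y
    by_cases hx : x ∈ K k
    · rw [extendZero_apply_mem _ _ hx, extendZero_apply_mem _ _ hx]
      exact ⟨h.1 _, h.2 _⟩
    · rw [extendZero_apply_notMem _ _ hx, extendZero_apply_notMem _ _ hx]
      exact ⟨le_rfl, le_rfl⟩
  exact ⟨ge_of_tendsto' hD fun k => (key k).1, le_of_tendsto_of_tendsto' hD hN fun k => (key k).2⟩

theorem neumann_symmetric {K : ℕ → Finset X} (hK : G.IsExhaustion K) {t : ℝ} (ht : 0 ≤ t)
    (f g : G.Ell2) :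
    inner ℝ (G.neumannForm.semigroup t f) g = inner ℝ f (G.neumannForm.semigroup t g) := by
  choose S hS using fun k => G.exists_diagonalizes_restrictedLaplacian (K k)
  exact heatLimit_symmetric (isSemigroupOf_neumann hK hS).2 ht f g

theorem dirichlet_symmetric {K : ℕ → Finset X} (hK : G.IsExhaustion K) {t : ℝ} (ht : 0 ≤ t)
    (f g : G.Ell2) :
    inner ℝ (G.dirichletForm.semigroup t f) g = inner ℝ f (G.dirichletForm.semigroup t g) := by
  choose S hS using fun k => G.exists_diagonalizes_dirichletLaplacian (K k)
  exact heatLimit_symmetric (isSemigroupOf_dirichlet hK hS).2 ht f g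

theorem neumann_injective {K : ℕ → Finset X} (hK : G.IsExhaustion K) {t : ℝ} (ht : 0 ≤ t)
    {f : G.Ell2} (h : G.neumannForm.semigroup t f = 0) : f = 0 := by
  choose S hS using fun k => G.exists_diagonalizes_restrictedLaplacian (K k)
  exact heatLimit_injective (isSemigroupOf_neumann hK hS).2 (tendsto_neumann_resolvent hK hS)
    neumannResolvent_injective ht h

theorem dirichlet_injective {K : ℕ → Finset X} (hK : G.IsExhaustion K) {t : ℝ} (ht : 0 ≤ t)
    {f : G.Ell2} (h : G.dirichletForm.semigroup t f = 0) : f = 0 := by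
  choose S hS using fun k => G.exists_diagonalizes_dirichletLaplacian (K k)
  exact heatLimit_injective (isSemigroupOf_dirichlet hK hS).2 (tendsto_dirichlet_resolvent hK hS)
    (dirichletResolvent_injective hK) ht h

theorem isSemigroupOf_neumannForm {K : ℕ → Finset X} (hK : G.IsExhaustion K) :
    IsSemigroupOf G.neumannForm.operatorGraph G.neumannForm.semigroup := by
  choose S hS using fun k => G.exists_diagonalizes_restrictedLaplacian (K k)
  exact (isSemigroupOf_neumann hK hS).1

theorem isSemigroupOf_dirichletForm {K : ℕ → Finset X} (hK : G.IsExhaustion K) :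
    IsSemigroupOf G.dirichletForm.operatorGraph G.dirichletForm.semigroup := by
  choose S hS using fun k => G.exists_diagonalizes_dirichletLaplacian (K k)
  exact (isSemigroupOf_dirichlet hK hS).1

/-- The Dirichlet semigroup maps into the domain of its generator. -/
theorem exists_mem_operatorGraph_dirichlet {K : ℕ → Finset X} (hK : G.IsExhaustion K) {t : ℝ}
    (ht : 0 < t) (f : G.Ell2) :
    ∃ g, (G.dirichletForm.semigroup t f, g) ∈ G.dirichletForm.operatorGraph := by
  choose S hS using fun k => G.exists_diagonalizes_dirichletLaplacian (K k)
  obtain ⟨h, hh⟩ := heatLimit_mem_range (isSemigroupOf_dirichlet hK hS).2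
    (tendsto_dirichlet_resolvent hK hS) (dirichletResolvent_injective hK) ht f
  refine ⟨h - G.dirichletForm.semigroup t f,
    ((represents_dirichletForm hK).mem_operatorGraph_iff _ _).2 ?_⟩
  rw [add_sub_cancel, hh]

theorem delta_mem_dirichletDomain (x : X) : delta G x ∈ G.dirichletDomain := by
  have h : (delta G x).FinitelySupported := finitelySupported_extendZero _ _
  refine ⟨G.finitelySupported_mem_neumannDomain h, fun ε hε => ⟨delta G x, h, ?_⟩⟩
  have h0 := G.formNormSq_smul 0 (delta G x)
  rw [zero_smul] at h0
  rw [sub_self, h0]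
  simpa using hε

/-- The generator of the Dirichlet semigroup acts as the formal Laplacian. -/
theorem operatorGraph_dirichlet_apply {f g : G.Ell2}
    (h : (f, g) ∈ G.dirichletForm.operatorGraph) (x : X) :
    G.m x * g x = ∑' y, G.b x y * (f x - f y) + G.c x * f x := by
  obtain ⟨hf, hfg⟩ := h
  have h1 : G.energy f (delta G x) = inner ℝ g (delta G x) :=
    hfg ⟨delta G x, delta_mem_dirichletDomain x⟩
  rw [energy_delta hf.1, inner_delta_right] at h1
  exact h1.symm

/-- Up to the factor `m x` the value is `‖P_{t/2} δ_x‖²`, and the semigroup is injective. -/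
theorem dirichlet_delta_self_pos {K : ℕ → Finset X} (hK : G.IsExhaustion K) {t : ℝ}
    (ht : 0 ≤ t) (x : X) : 0 < G.dirichletForm.semigroup t (delta G x) x := by
  have ht2 : 0 ≤ t / 2 := by positivity
  have h1 := (isSemigroupOf_dirichletForm hK).apply_add ht2 ht2 (delta G x)
  rw [add_halves] at h1
  rw [h1, apply_eq_inner, dirichlet_symmetric hK ht2, real_inner_self_eq_norm_sq]
  refine mul_pos (inv_pos.2 (G.m_pos x)) (pow_pos (norm_pos_iff.2 fun h => ?_) 2)
  exact delta_ne_zero x (dirichlet_injective hK ht2 h)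

/-- The Dirichlet semigroup of a connected graph is positivity improving. -/
theorem dirichlet_pos (hG : G.Connected) {K : ℕ → Finset X} (hK : G.IsExhaustion K) {t : ℝ}
    (ht : 0 < t) {f : G.Ell2} (hf : ∀ x, 0 ≤ f x) (hf0 : f ≠ 0) (x : X) :
    0 < G.dirichletForm.semigroup t f x := by
  set P := G.dirichletForm.semigroup with hP
  have hPs := isSemigroupOf_dirichletForm hK
  have hpos : ∀ {s : ℝ}, 0 ≤ s → ∀ {g : G.Ell2}, (∀ x, 0 ≤ g x) → ∀ x, 0 ≤ P s g x :=
    fun hs _ hg x => (dirichlet_nonneg_and_le_neumann hK hs hg x).1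
  refine lt_of_le_of_ne (hpos ht.le hf x) fun h0 => hf0 ?_
  -- A zero at `x` at time `t` propagates to earlier times: `v ≥ v(x) δ_x` gives `0 = P_{t-r} v (x)
  -- ≥ v(x) P_{t-r} δ_x (x)`, whose last factor is positive.
  have hZx : ∀ r, 0 < r → r < t → P r f x = 0 := by
    intro r hr hrt
    set v := P r f with hv
    have hv0 : ∀ y, 0 ≤ v y := hpos hr.le hf
    have hd : ∀ y, 0 ≤ (v - v x • delta G x) y := fun y => by
      rw [sub_apply, smul_apply]
      by_cases hy : y = x
      · subst hy; simp
      · rw [delta_of_ne hy]; simpa using hv0 y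
    have h1 := hpos (sub_nonneg.2 hrt.le) hd x
    have h2 : P (t - r) v = P t f := by
      rw [hv, ← hPs.apply_add (sub_nonneg.2 hrt.le) hr.le, sub_add_cancel]
    rw [map_sub, map_smul, h2, sub_apply, smul_apply, ← h0] at h1
    have h3 := dirichlet_delta_self_pos hK (sub_nonneg.2 hrt.le) x
    have h4 := hv0 x
    by_contra hne
    have h5 : 0 < v x := lt_of_le_of_ne h4 (Ne.symm hne)
    have h6 := mul_pos h5 h3
    linarith
  -- Vanishing at `y` over a time interval kills the time derivative there, so the Laplacian
  -- vanishes at `y`. What remains of it is `∑ b(y,z) P_r f(z) = 0` with nonnegative terms, so all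
  -- neighbours vanish too.
  have hstep : ∀ y z, 0 < G.b y z → (∀ r, 0 < r → r < t → P r f y = 0) →
      ∀ r, 0 < r → r < t → P r f z = 0 := by
    intro y z hyz hy r hr hrt
    obtain ⟨g, hg⟩ := exists_mem_operatorGraph_dirichlet hK hr f
    rw [← hP] at hg
    have hg0 : g y = 0 := by
      have h1 := tendsto_apply ((hPs.generator _ _).1 hg) y
      have h2 : Tendsto (fun _ : ℝ => (0 : ℝ)) (𝓝[>] 0) (𝓝 ((-g) y)) := by
        refine h1.congr' ?_
        have h3 : ∀ᶠ s : ℝ in 𝓝[>] 0, s < t - r :=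
          nhdsWithin_le_nhds (eventually_lt_nhds (sub_pos.2 hrt))
        filter_upwards [self_mem_nhdsWithin, h3] with s hs hs2
        have hs' : 0 < s := hs
        rw [smul_apply, sub_apply, ← hP, ← hPs.apply_add hs'.le hr.le,
          hy _ (by linarith) (by linarith), hy r hr hrt]
        simp
      have h3 := tendsto_nhds_unique h2 tendsto_const_nhds
      rw [neg_apply] at h3
      linarith
    have h1 := operatorGraph_dirichlet_apply hg y
    have hfin : G.FiniteEnergy (P r f) := hg.1.1
    have hsum : Summable fun z => G.b y z * P r f z :=
      (summable_mul_sub hfin y).neg.congr fun z => by rw [hy r hr hrt]; ring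
    have h2 : ∑' z, G.b y z * P r f z = 0 := by
      rw [hg0, hy r hr hrt, mul_zero, mul_zero, add_zero] at h1
      rw [← neg_eq_zero, ← tsum_neg, h1]
      exact tsum_congr fun z => by ring
    have h3 := (hasSum_zero_iff_of_nonneg fun z =>
      mul_nonneg (G.b_nonneg y z) (hpos hr.le hf z)).1 (h2 ▸ hsum.hasSum)
    exact (mul_eq_zero.1 (congrFun h3 z)).resolve_left hyz.ne'
  have hZ : ∀ y, ∀ r, 0 < r → r < t → P r f y = 0 := by
    intro y
    induction hG x y with
    | refl => exact hZx
    | tail _ h ih => exact hstep _ _ h ih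
  refine dirichlet_injective hK (t := t / 2) (by positivity) (Ell2.ext fun y => ?_)
  exact hZ y (t / 2) (by positivity) (by linarith)

/-! ### Equality of the semigroups and equality of the forms -/

/-- Zero is the sum of `P^N_{t-s}(P^N_s f - P^D_s f)` and `(P^N_{t-s} - P^D_{t-s}) P^D_s f`, both
nonnegative by domination. The first therefore vanishes, and `P^N_{t-s}` is injective. -/
theorem neumann_apply_eq_of_le {K : ℕ → Finset X} (hK : G.IsExhaustion K) {t : ℝ} {f : G.Ell2}
    (hf : ∀ x, 0 ≤ f x) (h : G.neumannForm.semigroup t f = G.dirichletForm.semigroup t f)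
    {s : ℝ} (hs : 0 ≤ s) (hst : s ≤ t) :
    G.neumannForm.semigroup s f = G.dirichletForm.semigroup s f := by
  have hts := sub_nonneg.2 hst
  have hD := (isSemigroupOf_dirichletForm hK).apply_add hts hs f
  have hN := (isSemigroupOf_neumannForm hK).apply_add hts hs f
  rw [sub_add_cancel] at hD hN
  have hdom := dirichlet_nonneg_and_le_neumann hK hs hf
  refine sub_eq_zero.1 (neumann_injective hK hts (Ell2.ext fun x => ?_))
  have h1 := dirichlet_nonneg_and_le_neumann hK hts
    (f := G.neumannForm.semigroup s f - G.dirichletForm.semigroup s f)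
    (fun x => sub_nonneg.2 (hdom x).2) x
  have h2 := dirichlet_nonneg_and_le_neumann hK hts (fun x => (hdom x).1) x
  rw [map_sub, sub_apply, ← hN, h, hD, zero_apply]
  rw [map_sub _ (G.neumannForm.semigroup s f), map_sub _ (G.neumannForm.semigroup s f), sub_apply,
    sub_apply, ← hN, h, hD] at h1
  linarith

theorem semigroup_eq_of_apply_eq (hG : G.Connected) {K : ℕ → Finset X} (hK : G.IsExhaustion K)
    {t : ℝ} (ht : 0 < t) {f : G.Ell2} (hf : ∀ x, 0 ≤ f x) (hf0 : f ≠ 0)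
    (h : G.neumannForm.semigroup t f = G.dirichletForm.semigroup t f) {r : ℝ} (hr : 0 ≤ r)
    (hrt : r ≤ t / 2) : G.neumannForm.semigroup r = G.dirichletForm.semigroup r := by
  have ht2 : 0 < t / 2 := by positivity
  set v := G.dirichletForm.semigroup (t / 2) f with hv
  have hv0 := dirichlet_pos hG hK ht2 hf hf0
  have hvr : G.neumannForm.semigroup r v = G.dirichletForm.semigroup r v := by
    rw [hv, ← (isSemigroupOf_dirichletForm hK).apply_add hr ht2.le,
      ← neumann_apply_eq_of_le hK hf h ht2.le (by linarith),
      ← (isSemigroupOf_neumannForm hK).apply_add hr ht2.le]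
    exact neumann_apply_eq_of_le hK hf h (by linarith) (by linarith)
  have hdelta : ∀ x, G.neumannForm.semigroup r (delta G x) =
      G.dirichletForm.semigroup r (delta G x) := by
    intro x
    ext y
    have hd : ∀ y, 0 ≤ (v - v x • delta G x) y := fun y => by
      rw [sub_apply, smul_apply]
      by_cases hy : y = x
      · subst hy; simp
      · rw [delta_of_ne hy]; simpa using (hv0 y).le
    have h1 := (dirichlet_nonneg_and_le_neumann hK hr hd y).2
    have h2 := (dirichlet_nonneg_and_le_neumann hK hr (delta_nonneg x) y).2
    rw [map_sub, map_sub, map_smul, map_smul, hvr, sub_apply, sub_apply, smul_apply,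
      smul_apply] at h1
    have h3 : v x * G.neumannForm.semigroup r (delta G x) y ≤
        v x * G.dirichletForm.semigroup r (delta G x) y := by linarith
    -- Domination applied to `v - v(x) δ_x ≥ 0`, with equality on `v`, gives the reverse inequality
    -- on `δ_x`; strict positivity of `v x` permits the cancellation.
    exact le_antisymm (le_of_mul_le_mul_left h3 (hv0 x)) h2
  ext g x
  rw [apply_eq_inner, apply_eq_inner (G.dirichletForm.semigroup r g), neumann_symmetric hK hr,
    dirichlet_symmetric hK hr, hdelta x]

theorem operatorGraph_eq_of_semigroup_eq {K : ℕ → Finset X} (hK : G.IsExhaustion K) {δ : ℝ}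
    (hδ : 0 < δ)
    (h : ∀ r, 0 ≤ r → r ≤ δ → G.neumannForm.semigroup r = G.dirichletForm.semigroup r) :
    G.dirichletForm.operatorGraph = G.neumannForm.operatorGraph := by
  ext ⟨f, g⟩
  rw [(isSemigroupOf_dirichletForm hK).generator, (isSemigroupOf_neumannForm hK).generator]
  refine tendsto_congr' ?_
  have h3 : ∀ᶠ s : ℝ in 𝓝[>] 0, s < δ := nhdsWithin_le_nhds (eventually_lt_nhds hδ)
  filter_upwards [self_mem_nhdsWithin, h3] with s hs hs2
  rw [h s (le_of_lt hs) hs2.le]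

/-- The operator determines the resolvent at `-1`, the resolvent determines the subspace of the
gradient space, and this determines the domain. The two forms are given by the same formula. -/
theorem dirichletForm_eq_of_operatorGraph_eq {K : ℕ → Finset X} (hK : G.IsExhaustion K)
    (h : G.dirichletForm.operatorGraph = G.neumannForm.operatorGraph) :
    G.dirichletForm = G.neumannForm := by
  have hD := represents_dirichletForm hK
  have hres : formResolvent G.gradientFst (G.dirichletSpace K) =
      formResolvent G.gradientFst G.neumannSpace := by
    refine ContinuousLinearMap.ext fun f => ?_
    set u := formResolvent G.gradientFst (G.dirichletSpace K) f with hu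
    have h1 : (u, f - u) ∈ G.dirichletForm.operatorGraph := by
      rw [hD.mem_operatorGraph_iff, add_sub_cancel]
    rw [h, G.represents_neumannForm.mem_operatorGraph_iff, add_sub_cancel] at h1
    exact h1
  have hspace := eq_of_formResolvent_eq (G.dirichletSpace_le_neumannSpace K)
    (fun w hw h0 => eq_zero_of_gradientFst_eq_zero hw h0) hres
  have hdom : G.dirichletDomain = G.neumannDomain := by
    refine le_antisymm (fun f hf => hf.1) fun f hf => ?_
    obtain ⟨w, hw, rfl⟩ := exists_lift hf
    rw [← hspace] at hw
    exact (hD.exists_inner_eq w hw).1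
  have hmk : ∀ D D' : Submodule ℝ G.Ell2, D = D' →
      (⟨D, fun f g => G.energy f.1 g.1⟩ : PartialForm G.Ell2) =
        ⟨D', fun f g => G.energy f.1 g.1⟩ := by
    rintro D _ rfl
    rfl
  exact hmk _ _ hdom

theorem dirichletForm_eq_of_apply_eq (hG : G.Connected) {K : ℕ → Finset X}
    (hK : G.IsExhaustion K) {t : ℝ} (ht : 0 < t) {f : G.Ell2} (hf : ∀ x, 0 ≤ f x) (hf0 : f ≠ 0)
    (h : G.neumannForm.semigroup t f = G.dirichletForm.semigroup t f) :
    G.dirichletForm = G.neumannForm :=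
  dirichletForm_eq_of_operatorGraph_eq hK (operatorGraph_eq_of_semigroup_eq hK (half_pos ht)
    fun _ hr hrt => semigroup_eq_of_apply_eq hG hK ht hf hf0 h hr hrt)

end GraphOver

end

/-! ### The equivalence -/

theorem mainTheorem2 {X : Type*} [Countable X] [Nonempty X] (G : GraphOver X)
    (hG : G.Connected) (K : ℕ → Finset X) (hK : G.IsExhaustion K) (t : ℝ) (ht : 0 < t) :
    List.TFAE [
      G.dirichletForm = G.neumannForm,
      ∀ f : G.Ell2, Filter.Tendsto (fun k => G.restrictedSemigroup (K k) t f) Filter.atTop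
        (nhds (G.dirichletSemigroup t f)),
      ∃ φ : G.Ell2, φ.FinitelySupported ∧ φ ≠ 0 ∧ ((∀ x, 0 ≤ φ x) ∨ (∀ x, φ x ≤ 0)) ∧
        ∀ x, Filter.Tendsto (fun k => G.restrictedSemigroup (K k) t φ x) Filter.atTop
          (nhds (G.dirichletSemigroup t φ x)),
      ∀ φ : G.Ell2, φ.FinitelySupported → φ ≠ 0 →
        ∀ x, Filter.Tendsto (fun k => G.restrictedSemigroup (K k) t φ x) Filter.atTop
          (nhds (G.dirichletSemigroup t φ x))] := by
  tfae_have 1 → 2 := fun h f => by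
    rw [GraphOver.dirichletSemigroup, h]
    exact GraphOver.tendsto_restrictedSemigroup hK ht.le f
  tfae_have 2 → 4 := fun h φ _ _ x => GraphOver.Ell2.tendsto_apply (h φ) x
  tfae_have 4 → 3 := fun h => by
    obtain ⟨x⟩ := ‹Nonempty X›
    have hx : (GraphOver.Ell2.delta G x).FinitelySupported := GraphOver.Ell2.finitelySupported_extendZero _ _
    exact ⟨GraphOver.Ell2.delta G x, hx, GraphOver.Ell2.delta_ne_zero x, Or.inl (GraphOver.Ell2.delta_nonneg x),
      h _ hx (GraphOver.Ell2.delta_ne_zero x)⟩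
  tfae_have 3 → 1 := by
    rintro ⟨φ, -, hφ0, hsign, hφ⟩
    -- The restricted semigroups converge to the Neumann semigroup in any case, so the assumed limit
    -- must coincide with it.
    have heq : G.neumannForm.semigroup t φ = G.dirichletForm.semigroup t φ :=
      GraphOver.Ell2.ext fun x => tendsto_nhds_unique
        (GraphOver.Ell2.tendsto_apply (GraphOver.tendsto_restrictedSemigroup hK ht.le φ) x) (hφ x)
    rcases hsign with h | h
    · exact GraphOver.dirichletForm_eq_of_apply_eq hG hK ht h hφ0 heq
    · refine GraphOver.dirichletForm_eq_of_apply_eq hG hK ht (f := -φ)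
        (fun x => by simpa using h x) (neg_ne_zero.2 hφ0) ?_
      rw [map_neg, map_neg, heq]
  tfae_finish
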